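/- Let $q$ be a prime power and let $\mathrm{PG}(n-1,q)$ be the $(n-1)$-dimensional projective space over the finite field with $q$ elements; a $d$-space is a subspace of projective dimension $d$. For $n \ge k \ge r \ge 1$, a $q$-covering design $\mathbb{C}_q(n,k,r)$ is a collection of $(k-1)$-spaces of $\mathrm{PG}(n-1,q)$ such that every $(r-1)$-space of $\mathrm{PG}(n-1,q)$ is contained in at least one member of the collection, and $\mathcal{C}_q(n,k,r)$ denotes the minimum number of $(k-1)$-spaces in such a design. Then $$q^{12}+q^2(q^4+1)(q^2+1)(q^2+q+1)+1 \;\le\; \mathcal{C}_q(8,4,3) \;\le\; q^{12}+q^4(q^2+1)^2(q^2+q+1)+1$$ and $$(q^4+1)(q^6+q^3+1)(q^8+q^6+q^4+q^2+1) \;\le\; \mathcal{C}_q(10,4,3) \;\le\; q^{18}+q^4(q^2+1)(q^2+q+1)(q^8+q^6+q^4+q^3+q^2+1)+1.$$ -/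

import Mathlib

/-- A `q`-covering design `ℂ_q(n, k, r)`, `F` being the field with `q` elements: a collection `X`
of `(k-1)`-spaces of `PG(n-1, q)` such that every `(r-1)`-space of `PG(n-1, q)` is contained in
at least one element of `X`. The space `PG(n-1, q)` is the lattice of linear subspaces of `F ^ n`,
and its `(d-1)`-spaces (projective dimension) are the subspaces of vector space dimension `d`. -/
def IsQCoveringDesign (F : Type*) [Field F] (n k r : ℕ)
    (X : Finset (Submodule F (Fin n → F))) : Prop :=
  (∀ U ∈ X, Module.finrank F U = k) ∧
    ∀ W : Submodule F (Fin n → F), Module.finrank F W = r → ∃ U ∈ X, W ≤ U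

/-- The number `𝒞_q(n, k, r)`, `F` being the field with `q` elements: the minimum number of
`(k-1)`-spaces in a `q`-covering design `ℂ_q(n, k, r)`. -/
noncomputable def qCoveringNumber (F : Type*) [Field F] (n k r : ℕ) : ℕ :=
  sInf {N : ℕ | ∃ X : Finset (Submodule F (Fin n → F)), IsQCoveringDesign F n k r X ∧ X.card = N}

/-! Lower bounds: every linearly independent triple spans a plane (vector dimension 3) lying in some
member of the design, and a 4-dimensional member contains `(q^4 - 1)(q^4 - q)(q^4 - q^2)` such
triples. Dividing the number of triples in `F ^ n` by this gives exactly the stated polynomials for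
`n = 8` and `n = 10`.

Upper bounds: fix a surjection `p : V → Q` whose kernel `K` has dimension 4, and sort the planes `W`
by `dim (W ⊓ K)`. Dimension 3 is covered by `K` itself. In dimensions 1 and 2, use a parallelism of
the projective space of `K`, that is, a partition of its lines into spreads. Lines of `Q` are
attached to parallel classes of `K`, and for each line `m` of `Q` and each line `l` of the attached
class one takes all `q^4` subspaces `U` with `U ⊓ K = l` and `p U = m`
(`exists_cover_of_isCrossRel`).

In dimension 0, `W` is the graph of a map defined on the image of `W`. For `n = 8` this image is a
hyperplane of `Q`, and a lifted maximum rank distance code of `q^12` maps suffices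
(`exists_lift_mrd`). For `n = 10`, `Q` has dimension 6 and is projected further by `ρ` to dimension
4. Planes that miss `ker (ρ ∘ p)` are covered by a code of size `q^18`; the others lie over the
preimage in `Q` of a line of the quotient, and each such preimage carries a code of size `q^12`.

The parallelism (`exists_isParallelRel`) comes from switching reguli in spreads of `L × L`, with `L`
quadratic over `F`, when `q ≠ 2`, and from an orbit of order 7 when `q = 2`. -/

open Module

/-! ### Counting independent tuples: lower bounds and numbers of lines -/

section Counting

variable {F M : Type*} [Field F] [Finite F] [AddCommGroup M] [Module F M] [Finite M]

theorem natCard_linearIndependent {r : ℕ} (hr : r ≤ finrank F M) :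
    Nat.card {s : Fin r → M // LinearIndependent F s} =
      ∏ i : Fin r, (Nat.card F ^ finrank F M - Nat.card F ^ i.val) := by
  have := Fintype.ofFinite F
  rw [card_linearIndependent hr, Nat.card_eq_fintype_card]

/-- Subspaces of dimension `k` that cover all `r`-dimensional subspaces: counting the independent
`r`-tuples bounds their number from below. -/
theorem prod_le_card_mul_prod_of_cover {k r : ℕ} (hrk : r ≤ k) (hr : r ≤ finrank F M)
    (X : Finset (Submodule F M)) (hX : ∀ U ∈ X, finrank F U = k)
    (hcov : ∀ W : Submodule F M, finrank F W = r → ∃ U ∈ X, W ≤ U) :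
    ∏ i : Fin r, (Nat.card F ^ finrank F M - Nat.card F ^ i.val) ≤
      X.card * ∏ i : Fin r, (Nat.card F ^ k - Nat.card F ^ i.val) := by
  rw [← natCard_linearIndependent hr]
  have key : ∀ s : {s : Fin r → M // LinearIndependent F s},
      ∃ U ∈ X, Submodule.span F (Set.range s.1) ≤ U := fun s ↦
    hcov _ (by simpa using finrank_span_eq_card s.2)
  choose U hU hsU using key
  let f : {s : Fin r → M // LinearIndependent F s} →
      Σ U : X, {s : Fin r → U.1 // LinearIndependent F s} := fun s ↦
    ⟨⟨U s, hU s⟩, fun i ↦ ⟨s.1 i, hsU s (Submodule.subset_span ⟨i, rfl⟩)⟩,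
      LinearIndependent.of_comp (U s).subtype s.2⟩
  let g : (Σ U : X, {s : Fin r → U.1 // LinearIndependent F s}) → (Fin r → M) :=
    fun p i ↦ (p.2.1 i : M)
  have hf : Function.Injective f := by
    intro s t h
    exact Subtype.ext (congrArg g h)
  refine (Nat.card_le_card_of_injective f hf).trans ?_
  rw [Nat.card_sigma]
  calc _ = ∑ U : X, ∏ i : Fin r, (Nat.card F ^ k - Nat.card F ^ i.val) := by
        refine Finset.sum_congr rfl fun U _ ↦ ?_
        rw [natCard_linearIndependent (by rw [hX _ U.2]; exact hrk), hX _ U.2]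
    _ ≤ _ := by simp

/-- An independent `r`-tuple in an `r`-dimensional `W` determines `W` as its span, so pairs of a
subspace and a basis inject into the tuples of `M`. Equality holds, but only this direction is
needed, to bound the size of the construction. -/
theorem natCard_submodule_mul_prod_le {r : ℕ} (hr : r ≤ finrank F M) :
    Nat.card {W : Submodule F M // finrank F W = r} *
        ∏ i : Fin r, (Nat.card F ^ r - Nat.card F ^ i.val) ≤
      ∏ i : Fin r, (Nat.card F ^ finrank F M - Nat.card F ^ i.val) := by
  rw [← natCard_linearIndependent hr]
  have := Fintype.ofFinite {W : Submodule F M // finrank F W = r}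
  let g : (Σ W : {W : Submodule F M // finrank F W = r},
      {s : Fin r → W.1 // LinearIndependent F s}) → {s : Fin r → M // LinearIndependent F s} :=
    fun p ↦ ⟨fun i ↦ (p.2.1 i : M), p.2.2.map' p.1.1.subtype (Submodule.ker_subtype _)⟩
  have hspan : ∀ p, p.1.1 = Submodule.span F (Set.range (g p).1) := by
    rintro ⟨⟨W, hW⟩, s, hs⟩
    symm
    refine Submodule.eq_of_le_of_finrank_eq ?_ ?_
    · rw [Submodule.span_le]
      rintro _ ⟨i, rfl⟩
      exact (s i).2
    · rw [finrank_span_eq_card (g ⟨⟨W, hW⟩, s, hs⟩).2, hW, Fintype.card_fin]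
  have hg : Function.Injective g := by
    intro p p' h
    have h1 : p.1 = p'.1 := Subtype.ext (by rw [hspan p, hspan p', h])
    obtain ⟨W, s, hs⟩ := p
    obtain ⟨W', s', hs'⟩ := p'
    obtain rfl : W = W' := h1
    have : s = s' := by
      ext i
      exact congrFun (congrArg Subtype.val h) i
    subst this
    rfl
  refine le_trans (le_of_eq ?_) (Nat.card_le_card_of_injective g hg)
  rw [Nat.card_sigma]
  calc _ = ∑ W : {W : Submodule F M // finrank F W = r},
        ∏ i : Fin r, (Nat.card F ^ r - Nat.card F ^ i.val) := by simp
    _ = _ := by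
        refine Finset.sum_congr rfl fun W _ ↦ ?_
        rw [natCard_linearIndependent W.2.ge, W.2]

theorem two_le_natCard : 2 ≤ Nat.card F := Finite.one_lt_card

theorem natCard_lines_le_of_finrank_eq_four (h : finrank F M = 4) :
    Nat.card {W : Submodule F M // finrank F W = 2} ≤
      (Nat.card F ^ 2 + 1) * (Nat.card F ^ 2 + Nat.card F + 1) := by
  have key := natCard_submodule_mul_prod_le (F := F) (M := M) (r := 2) (by omega)
  have hq := two_le_natCard (F := F)
  rw [h] at key
  generalize Nat.card F = q at *
  -- Writing `q = 2 + t` turns the truncated differences into products of positive polynomials, so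
  -- that the common factor `(q^2 - 1)(q^2 - q)` can be cancelled.
  obtain ⟨t, rfl⟩ := Nat.exists_eq_add_of_le hq
  simp only [Fin.prod_univ_two, Fin.val_zero, Fin.val_one, pow_zero, pow_one] at key
  have e1 : (2 + t) ^ 2 - 1 = (t + 1) * (t + 3) := by
    rw [Nat.sub_eq_iff_eq_add (by nlinarith)]; ring
  have e2 : (2 + t) ^ 2 - (2 + t) = (t + 1) * (t + 2) := by
    rw [Nat.sub_eq_iff_eq_add (by nlinarith)]; ring
  have e3 : (2 + t) ^ 4 - 1 = (t + 1) * (t + 3) * ((2 + t) ^ 2 + 1) := by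
    rw [Nat.sub_eq_iff_eq_add (Nat.one_le_pow _ _ (by omega))]; ring
  have e4 : (2 + t) ^ 4 - (2 + t) = (t + 1) * (t + 2) * ((2 + t) ^ 2 + (2 + t) + 1) := by
    rw [Nat.sub_eq_iff_eq_add (Nat.le_self_pow (by norm_num) _)]; ring
  rw [e1, e2, e3, e4] at key
  refine Nat.le_of_mul_le_mul_right (c := (t + 1) * (t + 3) * ((t + 1) * (t + 2))) ?_
    (by positivity)
  linarith

theorem natCard_lines_le_of_finrank_eq_six (h : finrank F M = 6) :
    Nat.card {W : Submodule F M // finrank F W = 2} ≤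
      (Nat.card F ^ 4 + Nat.card F ^ 2 + 1) *
        (Nat.card F ^ 4 + Nat.card F ^ 3 + Nat.card F ^ 2 + Nat.card F + 1) := by
  have key := natCard_submodule_mul_prod_le (F := F) (M := M) (r := 2) (by omega)
  have hq := two_le_natCard (F := F)
  rw [h] at key
  generalize Nat.card F = q at *
  obtain ⟨t, rfl⟩ := Nat.exists_eq_add_of_le hq
  simp only [Fin.prod_univ_two, Fin.val_zero, Fin.val_one, pow_zero, pow_one] at key
  have e1 : (2 + t) ^ 2 - 1 = (t + 1) * (t + 3) := by
    rw [Nat.sub_eq_iff_eq_add (by nlinarith)]; ring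
  have e2 : (2 + t) ^ 2 - (2 + t) = (t + 1) * (t + 2) := by
    rw [Nat.sub_eq_iff_eq_add (by nlinarith)]; ring
  have e3 : (2 + t) ^ 6 - 1 = (t + 1) * (t + 3) * ((2 + t) ^ 4 + (2 + t) ^ 2 + 1) := by
    rw [Nat.sub_eq_iff_eq_add (Nat.one_le_pow _ _ (by omega))]; ring
  have e4 : (2 + t) ^ 6 - (2 + t) = (t + 1) * (t + 2) *
      ((2 + t) ^ 4 + (2 + t) ^ 3 + (2 + t) ^ 2 + (2 + t) + 1) := by
    rw [Nat.sub_eq_iff_eq_add (Nat.le_self_pow (by norm_num) _)]; ring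
  rw [e1, e2, e3, e4] at key
  refine Nat.le_of_mul_le_mul_right (c := (t + 1) * (t + 3) * ((t + 1) * (t + 2))) ?_
    (by positivity)
  linarith

/-- The counting bound `(q^(n) - 1)(q^(n) - q)(q^(n) - q^2) / ((q^4 - 1)(q^4 - q)(q^4 - q^2))` with
the divisions carried out. -/
theorem le_card_of_cover_four_three {n a b : ℕ} (hn : 3 ≤ n) (X : Finset (Submodule F M))
    (hM : finrank F M = n) (hX : ∀ U ∈ X, finrank F U = 4)
    (hcov : ∀ W : Submodule F M, finrank F W = 3 → ∃ U ∈ X, W ≤ U)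
    (hab : a * ((Nat.card F ^ 4 - 1) * (Nat.card F ^ 4 - Nat.card F) *
      (Nat.card F ^ 4 - Nat.card F ^ 2)) = b)
    (hb : b = (Nat.card F ^ n - 1) * (Nat.card F ^ n - Nat.card F) *
      (Nat.card F ^ n - Nat.card F ^ 2)) : a ≤ X.card := by
  have key := prod_le_card_mul_prod_of_cover (by norm_num : 3 ≤ 4) (hM ▸ hn) X hX hcov
  rw [hM] at key
  simp only [Fin.prod_univ_three, Fin.val_zero, Fin.val_one, Fin.val_two, pow_zero,
    pow_one] at key
  rw [← hb, ← hab] at key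
  have hq := two_le_natCard (F := F)
  refine Nat.le_of_mul_le_mul_right key ?_
  have h1 : 1 < Nat.card F ^ 4 := Nat.one_lt_pow (by norm_num) hq
  have h2 : Nat.card F ^ 1 < Nat.card F ^ 4 := Nat.pow_lt_pow_right hq (by norm_num)
  have h3 : Nat.card F ^ 2 < Nat.card F ^ 4 := Nat.pow_lt_pow_right hq (by norm_num)
  rw [pow_one] at h2
  exact Nat.mul_pos (Nat.mul_pos (by omega) (by omega)) (by omega)

end Counting

theorem schonheim_product_eight {q : ℕ} (hq : 2 ≤ q) :
    (q ^ 12 + q ^ 2 * (q ^ 4 + 1) * (q ^ 2 + 1) * (q ^ 2 + q + 1) + 1) *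
      ((q ^ 4 - 1) * (q ^ 4 - q) * (q ^ 4 - q ^ 2)) =
      (q ^ 8 - 1) * (q ^ 8 - q) * (q ^ 8 - q ^ 2) := by
  have h {m n : ℕ} (hmn : m ≤ n) : q ^ m ≤ q ^ n := Nat.pow_le_pow_right (by omega) hmn
  zify [h (m := 2) (n := 4) (by norm_num), h (m := 2) (n := 8) (by norm_num),
    Nat.le_self_pow (n := 4) (by norm_num) q, Nat.le_self_pow (n := 8) (by norm_num) q,
    Nat.one_le_pow 4 q (by omega), Nat.one_le_pow 8 q (by omega)]
  ring

theorem schonheim_product_ten {q : ℕ} (hq : 2 ≤ q) :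
    ((q ^ 4 + 1) * (q ^ 6 + q ^ 3 + 1) * (q ^ 8 + q ^ 6 + q ^ 4 + q ^ 2 + 1)) *
      ((q ^ 4 - 1) * (q ^ 4 - q) * (q ^ 4 - q ^ 2)) =
      (q ^ 10 - 1) * (q ^ 10 - q) * (q ^ 10 - q ^ 2) := by
  have h {m n : ℕ} (hmn : m ≤ n) : q ^ m ≤ q ^ n := Nat.pow_le_pow_right (by omega) hmn
  zify [h (m := 2) (n := 4) (by norm_num), h (m := 2) (n := 10) (by norm_num),
    Nat.le_self_pow (n := 4) (by norm_num) q, Nat.le_self_pow (n := 10) (by norm_num) q,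
    Nat.one_le_pow 4 q (by omega), Nat.one_le_pow 10 q (by omega)]
  ring

/-! ### Lifting linear maps to subspaces, and rank distance codes -/

section Lift

theorem LinearMap.exists_comp_eq_of_ker_le {F W Q T : Type*} [Field F] [AddCommGroup W] [Module F W]
    [AddCommGroup Q] [Module F Q] [AddCommGroup T] [Module F T] (a : W →ₗ[F] Q) (b : W →ₗ[F] T)
    (h : LinearMap.ker a ≤ LinearMap.ker b) : ∃ g : Q →ₗ[F] T, ∀ w, g (a w) = b w := by
  obtain ⟨s, hs⟩ := a.rangeRestrict.exists_rightInverse_of_surjective a.range_rangeRestrict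
  obtain ⟨g, hg⟩ := LinearMap.exists_extend (p := LinearMap.range a) (b ∘ₗ s)
  refine ⟨g, fun w ↦ ?_⟩
  have h1 : g (a w) = b (s (a.rangeRestrict w)) := LinearMap.congr_fun hg (a.rangeRestrict w)
  have h2 : a (s (a.rangeRestrict w)) = a w :=
    congrArg Subtype.val (LinearMap.congr_fun hs (a.rangeRestrict w))
  rw [h1, ← sub_eq_zero, ← map_sub]
  exact h (by rw [LinearMap.mem_ker, map_sub, h2, sub_self])

theorem Submodule.finrank_map_add_finrank_inf_ker {F V Q : Type*} [Field F] [AddCommGroup V]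
    [Module F V] [AddCommGroup Q] [Module F Q] (p : V →ₗ[F] Q) (U : Submodule F V)
    [FiniteDimensional F U] :
    finrank F (U.map p) + finrank F ↥(U ⊓ LinearMap.ker p) = finrank F U := by
  rw [← LinearMap.finrank_range_add_finrank_ker (p.domRestrict U), LinearMap.range_domRestrict,
    LinearMap.ker_domRestrict, ← Submodule.map_comap_subtype, Submodule.finrank_map_subtype_eq]

variable {F V Q : Type*} [Field F] [AddCommGroup V] [Module F V] [Finite V]
  [AddCommGroup Q] [Module F Q] [Finite Q]

/-- Lifting a set `C` of linear maps `Q → T`, where `T` is `ker p` modulo `l`, to subspaces of `V`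
that are mapped onto `n` by `p : V → Q` and meet `ker p` in `l`. -/
theorem exists_lift {T : Type*} [AddCommGroup T] [Module F T] (p : V →ₗ[F] Q)
    (hp : Function.Surjective p) (n : Submodule F Q) (l : Submodule F V) (hl : l ≤ LinearMap.ker p)
    (hT : finrank F T + finrank F l = finrank F (LinearMap.ker p)) [Finite T]
    (C : Finset (Q →ₗ[F] T)) :
    ∃ Y : Finset (Submodule F V), Y.card ≤ C.card ∧
      (∀ U ∈ Y, finrank F U = finrank F n + finrank F l) ∧
      ∀ W : Submodule F V, W.map p ≤ n → W ⊓ LinearMap.ker p ≤ l →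
        (∀ g : Q →ₗ[F] T, ∃ f ∈ C, ∀ x ∈ W.map p, f x = g x) → ∃ U ∈ Y, W ≤ U := by
  classical
  obtain ⟨s, hs⟩ := p.exists_rightInverse_of_surjective (LinearMap.range_eq_top.2 hp)
  have hs' : ∀ x, p (s x) = x := fun x ↦ LinearMap.congr_fun hs x
  set K := LinearMap.ker p with hK
  let r : V →ₗ[F] K := (LinearMap.id - s ∘ₗ p).codRestrict K fun v ↦ by
    simp [hK, hs']
  have hr : ∀ v (hv : v ∈ K), r v = ⟨v, hv⟩ := by
    intro v hv
    apply Subtype.ext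
    have : p v = 0 := hv
    simp [r, this]
  have hrs : ∀ x, r (s x) = 0 := by
    intro x
    apply Subtype.ext
    simp [r, hs']
  let l' : Submodule F K := l.comap K.subtype
  have hl' : finrank F l' = finrank F l := by
    rw [← Submodule.finrank_map_subtype_eq, Submodule.map_comap_subtype, inf_eq_right.2 hl]
  let e : (K ⧸ l') ≃ₗ[F] T := LinearEquiv.ofFinrankEq _ _ (by
    have := Submodule.finrank_quotient_add_finrank l'
    omega)
  -- `th` is the `T`-coordinate on `V`: it vanishes on the chosen complement `s(Q)` of `K`, and
  -- restricted to `K` it is the quotient map by `l`.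
  let th : V →ₗ[F] T := e.toLinearMap ∘ₗ l'.mkQ ∘ₗ r
  have hth : ∀ v ∈ K, th v = 0 ↔ v ∈ l := by
    intro v hv
    simp [th, hr v hv, l']
  have hths : ∀ x, th (s x) = 0 := by simp [th, hrs]
  have hsurj : ∀ t, ∃ v ∈ K, th v = t := by
    intro t
    obtain ⟨k, hk⟩ := l'.mkQ_surjective (e.symm t)
    exact ⟨k, k.2, by simp only [th, LinearMap.comp_apply, hr _ k.2]; simp [hk]⟩
  let U : (Q →ₗ[F] T) → Submodule F V := fun f ↦ n.comap p ⊓ LinearMap.ker (th - f ∘ₗ p)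
  have hU : ∀ f v, v ∈ U f ↔ p v ∈ n ∧ th v = f (p v) := by
    intro f v
    simp [U, sub_eq_zero]
  refine ⟨C.image U, Finset.card_image_le, ?_, ?_⟩
  · intro U' hU'
    obtain ⟨f, -, rfl⟩ := Finset.mem_image.1 hU'
    have h1 : (U f).map p = n := by
      apply le_antisymm
      · rintro _ ⟨v, hv, rfl⟩
        exact ((hU f v).1 hv).1
      · intro x hx
        obtain ⟨k, hk, hkt⟩ := hsurj (f x)
        have hk0 : p k = 0 := hk
        exact ⟨s x + k, (hU _ _).2 (by simp [hs', hk0, hx, hths, hkt]), by simp [hs', hk0]⟩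
    have h2 : U f ⊓ LinearMap.ker p = l := by
      ext v
      rw [Submodule.mem_inf, hU]
      constructor
      · rintro ⟨⟨-, h⟩, hv⟩
        have hv' : p v = 0 := hv
        exact (hth v hv).1 (by rw [h, hv', map_zero])
      · intro hv
        have hv' : p v = 0 := hl hv
        exact ⟨⟨by rw [hv']; exact n.zero_mem, by rw [hv', map_zero]; exact (hth v (hl hv)).2 hv⟩,
          hl hv⟩
    rw [← Submodule.finrank_map_add_finrank_inf_ker p, h1, h2]
  · intro W hW hWl hC
    -- Since `W ⊓ ker p ≤ l`, the restriction of `th` to `W` factors through `p` as `g ∘ p`. Hence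
    -- `W ≤ U f` as soon as `f` agrees with `g` on the image of `W`.
    obtain ⟨g, hg⟩ := LinearMap.exists_comp_eq_of_ker_le (p.domRestrict W) (th.domRestrict W) (by
      rintro ⟨w, hw⟩ h
      have hk : p w = 0 := h
      exact (hth w hk).2 (hWl ⟨hw, hk⟩))
    obtain ⟨f, hf, hfg⟩ := hC g
    refine ⟨U f, Finset.mem_image_of_mem _ hf, fun w hw ↦ (hU _ _).2 ⟨hW ⟨w, hw, rfl⟩, ?_⟩⟩
    rw [hfg _ ⟨w, hw, rfl⟩]
    exact (hg ⟨w, hw⟩).symm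

variable [Finite F]

/-- All subspaces with given intersection with `ker p` and given image under `p`. -/
theorem exists_lift_all (p : V →ₗ[F] Q) (hp : Function.Surjective p) (n : Submodule F Q)
    (l : Submodule F V) (hl : l ≤ LinearMap.ker p) {t : ℕ}
    (ht : t + finrank F l = finrank F (LinearMap.ker p)) :
    ∃ Y : Finset (Submodule F V), Y.card ≤ Nat.card F ^ (finrank F n * t) ∧
      (∀ U ∈ Y, finrank F U = finrank F n + finrank F l) ∧
      ∀ W : Submodule F V, W.map p ≤ n → W ⊓ LinearMap.ker p ≤ l → ∃ U ∈ Y, W ≤ U := by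
  classical
  -- Only values on `n` matter, so one extension to `Q` is chosen for each map on `n`; this keeps
  -- the count at the size of `Hom(n, F ^ t)`.
  have hex : ∀ f : n →ₗ[F] (Fin t → F), ∃ g : Q →ₗ[F] (Fin t → F), g ∘ₗ n.subtype = f :=
    fun f ↦ LinearMap.exists_extend f
  choose E hE using hex
  have : Finite (n →ₗ[F] (Fin t → F)) := Module.finite_of_finite F
  have := Fintype.ofFinite (n →ₗ[F] (Fin t → F))
  obtain ⟨Y, hY, hdim, hcov⟩ := exists_lift (T := Fin t → F) p hp n l hl (by simpa using ht)
    (Finset.univ.image E)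
  refine ⟨Y, ?_, hdim, fun W hW hWl ↦ hcov W hW hWl fun g ↦ ?_⟩
  · refine hY.trans (Finset.card_image_le.trans ?_)
    rw [Finset.card_univ, ← Nat.card_eq_fintype_card, Module.natCard_eq_pow_finrank (K := F),
      Module.finrank_linearMap, Module.finrank_fin_fun]
  · refine ⟨E (g ∘ₗ n.subtype), Finset.mem_image_of_mem _ (Finset.mem_univ _), fun x hx ↦ ?_⟩
    exact LinearMap.congr_fun (hE (g ∘ₗ n.subtype)) ⟨x, hW hx⟩

theorem exists_extension_field (F : Type*) [Field F] [Finite F] {d : ℕ} (hd : d ≠ 0) :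
    ∃ (K : Type) (_ : Field K) (_ : Algebra F K) (_ : Finite K), finrank F K = d := by
  obtain ⟨p, hp⟩ := CharP.exists F
  have : Fact p.Prime := ⟨CharP.char_is_prime F p⟩
  have : NeZero d := ⟨hd⟩
  exact ⟨FiniteField.Extension F p d, inferInstance, inferInstance, inferInstance,
    FiniteField.finrank_extension F p d⟩

/-- A maximum rank distance code: linear maps out of a `4`-dimensional space that prescribe the
values on each hyperplane arbitrarily. -/
theorem exists_mrd_code {N T : Type*} [AddCommGroup N] [Module F N] [Finite N] [AddCommGroup T]
    [Module F T] [Finite T] (hN : finrank F N = 4) (hT : 4 ≤ finrank F T) :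
    ∃ C : Finset (N →ₗ[F] T), C.card ≤ Nat.card F ^ (3 * finrank F T) ∧
      ∀ A : Submodule F N, A ≠ ⊤ → ∀ g : N →ₗ[F] T, ∃ f ∈ C, ∀ x ∈ A, f x = g x := by
  classical
  obtain ⟨K, _, _, _, hK⟩ := exists_extension_field F (d := finrank F T) (by omega)
  let e : T ≃ₗ[F] K := LinearEquiv.ofFinrankEq _ _ hK.symm
  let b : Basis (Fin 4) F N := finBasisOfFinrankEq F N hN
  let v : Fin 4 → K := fun i ↦ finBasis F K (Fin.castLE (by omega) i)
  have hv : LinearIndependent F v :=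
    (finBasis F K).linearIndependent.comp _ (Fin.castLE_injective _)
  -- The code is the kernel of a single parity check with values in the field `K` of degree `dim T`,
  -- its coefficients `v i` being independent over `F`.
  let m : (N →ₗ[F] T) →ₗ[F] K :=
    { toFun := fun f ↦ ∑ i, v i * e (f (b i))
      map_add' := fun f g ↦ by simp [mul_add, Finset.sum_add_distrib]
      map_smul' := fun c f ↦ by simp [Finset.smul_sum] }
  have hm : ∀ f, m f = ∑ i, v i * e (f (b i)) := fun f ↦ rfl
  have : Finite (N →ₗ[F] T) := Module.finite_of_finite F
  have := Fintype.ofFinite (N →ₗ[F] T)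
  -- On rank one maps with fixed functional `g₀`, the check is multiplication by a scalar of `K`,
  -- which is nonzero when `g₀ ≠ 0` by independence of the `v i`.
  have hrank : ∀ (g₀ : N →ₗ[F] F) (k : K), ∃ t : T, m (g₀.smulRight t) =
      (∑ i, g₀ (b i) • v i) * k := by
    intro g₀ k
    refine ⟨e.symm k, ?_⟩
    rw [hm, Finset.sum_mul]
    refine Finset.sum_congr rfl fun i _ ↦ ?_
    simp
  have hne : ∀ g₀ : N →ₗ[F] F, g₀ ≠ 0 → ∑ i, g₀ (b i) • v i ≠ 0 := by
    intro g₀ h0 h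
    apply h0
    refine b.ext fun i ↦ ?_
    rw [Fintype.linearIndependent_iff.1 hv _ h i, LinearMap.zero_apply]
  have hsurj : LinearMap.range m = ⊤ := by
    rw [LinearMap.range_eq_top]
    intro k
    have h0 : (b.coord 0 : N →ₗ[F] F) ≠ 0 := fun h ↦ by
      simpa using LinearMap.congr_fun h (b 0)
    obtain ⟨t, ht⟩ := hrank _ ((∑ i, b.coord 0 (b i) • v i)⁻¹ * k)
    exact ⟨_, ht.trans (mul_inv_cancel_left₀ (hne _ h0) k)⟩
  refine ⟨Finset.univ.filter (· ∈ LinearMap.ker m), ?_, ?_⟩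
  · have h1 := LinearMap.finrank_range_add_finrank_ker m
    rw [hsurj, finrank_top, hK, finrank_linearMap, hN] at h1
    have h2 : (Finset.univ.filter (· ∈ LinearMap.ker m)).card = Nat.card (LinearMap.ker m) := by
      rw [Nat.card_eq_fintype_card, Fintype.card_subtype]
    rw [h2, Module.natCard_eq_pow_finrank (K := F), show finrank F (LinearMap.ker m) =
      3 * finrank F T by omega]
  · intro A hA g
    -- A rank one map that vanishes on `A` corrects `g` to a codeword without changing it on `A`.
    obtain ⟨g₀, h0, hA0⟩ := A.exists_le_ker_of_lt_top (lt_top_iff_ne_top.2 hA)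
    obtain ⟨t, ht⟩ := hrank g₀ ((∑ i, g₀ (b i) • v i)⁻¹ * m g)
    rw [mul_inv_cancel_left₀ (hne _ h0)] at ht
    refine ⟨g - g₀.smulRight t, by simp [ht], fun x hx ↦ ?_⟩
    have : g₀ x = 0 := hA0 hx
    simp [this]

/-- The lifted maximum rank distance code over a `4`-dimensional subspace `n` of `Q`. -/
theorem exists_lift_mrd (p : V →ₗ[F] Q) (hp : Function.Surjective p) (n : Submodule F Q)
    (hn : finrank F n = 4) (hker : 4 ≤ finrank F (LinearMap.ker p)) :
    ∃ Y : Finset (Submodule F V), Y.card ≤ Nat.card F ^ (3 * finrank F (LinearMap.ker p)) ∧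
      (∀ U ∈ Y, finrank F U = 4) ∧
      ∀ W : Submodule F V, finrank F W = 3 → W.map p ≤ n → W ⊓ LinearMap.ker p = ⊥ →
        ∃ U ∈ Y, W ≤ U := by
  classical
  obtain ⟨C, hC, hagree⟩ := exists_mrd_code (N := n) (T := LinearMap.ker p) hn hker
  choose E hE using fun f : n →ₗ[F] LinearMap.ker p ↦ LinearMap.exists_extend f
  obtain ⟨Y, hY, hdim, hcov⟩ := exists_lift p hp n ⊥ bot_le (by simp) (C.image E)
  refine ⟨Y, hY.trans (Finset.card_image_le.trans hC), fun U hU ↦ by simp [hdim U hU, hn],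
    fun W hW hWn hWk ↦ hcov W hWn hWk.le fun g ↦ ?_⟩
  -- The image of the 3-dimensional `W` is a proper subspace of the 4-dimensional `n`, so some
  -- codeword takes the required values there.
  obtain ⟨f, hf, hfg⟩ := hagree ((W.map p).comap n.subtype) (by
    intro h
    rw [Submodule.comap_subtype_eq_top] at h
    have h1 := Submodule.finrank_mono h
    have h2 := Submodule.finrank_map_le p W
    omega) (g ∘ₗ n.subtype)
  refine ⟨E f, Finset.mem_image_of_mem _ hf, fun x hx ↦ ?_⟩
  have h1 : E f x = f ⟨x, hWn hx⟩ := LinearMap.congr_fun (hE f) ⟨x, hWn hx⟩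
  rw [h1, hfg _ (by exact hx)]
  rfl

end Lift

/-! ### Parallelisms as relations between lines -/

/-- A relation between the lines of a projective space, such as being in the same class of a
parallelism, for which the lines related to a given line cover all points, and are at most as many
as the lines of a spread of a three-dimensional projective space. -/
structure IsParallelRel (F : Type*) {M : Type*} [Field F] [AddCommGroup M] [Module F M]
    (r : Submodule F M → Submodule F M → Prop) : Prop where
  symm : ∀ m l, r m l → r l m
  finrank_eq : ∀ m l, r m l → finrank F l = 2
  cover : ∀ m : Submodule F M, finrank F m = 2 → ∀ x, ∃ l, r m l ∧ x ∈ l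
  card_le : ∀ m, ∃ s : Finset (Submodule F M), s.card ≤ Nat.card F ^ 2 + 1 ∧ ∀ l, r m l → l ∈ s

/-- `huniq` asks for equality of the spreads, not of their indices, because the family used for `q ≠
2` lists each switched spread under several indices. -/
theorem exists_isParallelRel_of_family {F M I : Type*} [Field F] [AddCommGroup M] [Module F M]
    (S : I → Finset (Submodule F M)) (hcard : ∀ i, (S i).card ≤ Nat.card F ^ 2 + 1)
    (hdim : ∀ i, ∀ l ∈ S i, finrank F l = 2) (hcov : ∀ i x, ∃ l ∈ S i, x ∈ l)
    (hex : ∀ l : Submodule F M, finrank F l = 2 → ∃ i, l ∈ S i)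
    (huniq : ∀ i j l, l ∈ S i → l ∈ S j → S i = S j) :
    ∃ r : Submodule F M → Submodule F M → Prop, IsParallelRel F r := by
  refine ⟨fun m l ↦ ∃ i, m ∈ S i ∧ l ∈ S i, ⟨?_, ?_, ?_, ?_⟩⟩
  · rintro m l ⟨i, hm, hl⟩
    exact ⟨i, hl, hm⟩
  · rintro m l ⟨i, hm, hl⟩
    exact hdim i l hl
  · intro m hm x
    obtain ⟨i, hi⟩ := hex m hm
    obtain ⟨l, hl, hx⟩ := hcov i x
    exact ⟨l, ⟨i, hi, hl⟩, hx⟩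
  · intro m
    by_cases h : ∃ i, m ∈ S i
    · obtain ⟨i, hi⟩ := h
      refine ⟨S i, hcard i, ?_⟩
      rintro l ⟨j, hm, hl⟩
      rwa [huniq i j m hi hm]
    · refine ⟨∅, by simp, ?_⟩
      rintro l ⟨j, hm, hl⟩
      exact absurd ⟨j, hm⟩ h

theorem IsParallelRel.map_equiv {F M M' : Type*} [Field F] [AddCommGroup M] [Module F M]
    [AddCommGroup M'] [Module F M'] (e : M' ≃ₗ[F] M) {r : Submodule F M → Submodule F M → Prop}
    (hr : IsParallelRel F r) :
    IsParallelRel F fun m l : Submodule F M' ↦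
      r (m.map (e : M' →ₗ[F] M)) (l.map (e : M' →ₗ[F] M)) := by
  classical
  refine ⟨fun m l h ↦ hr.symm _ _ h, fun m l h ↦ ?_, fun m hm x ↦ ?_, fun m ↦ ?_⟩
  · rw [← LinearEquiv.finrank_map_eq e l]
    exact hr.finrank_eq _ _ h
  · obtain ⟨l, hl, hx⟩ := hr.cover (m.map (e : M' →ₗ[F] M))
      (by rw [← hm]; exact LinearEquiv.finrank_map_eq e m) (e x)
    refine ⟨l.comap (e : M' →ₗ[F] M), ?_, hx⟩
    rwa [Submodule.map_comap_eq_of_surjective e.surjective]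
  · obtain ⟨s, hs, hl⟩ := hr.card_le (m.map (e : M' →ₗ[F] M))
    refine ⟨s.image (Submodule.comap (e : M' →ₗ[F] M)), Finset.card_image_le.trans hs,
      fun l h ↦ Finset.mem_image.2 ⟨_, hl _ h, ?_⟩⟩
    exact Submodule.comap_map_eq_of_injective e.injective l

/-! ### Quadratic extensions and norm values -/

section QuadraticExtension

variable {F L : Type*} [Field F] [Field L] [Algebra F L] [Finite L]

/-- The involution is the Frobenius map `x ↦ x ^ q`, and `b * σ b = b ^ (q + 1)` is the norm, which
is surjective over finite fields. -/
theorem exists_involution_of_finrank_eq_two [Finite F] (hL : finrank F L = 2) :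
    ∃ σ : L →ₐ[F] L, (∀ x, σ (σ x) = x) ∧ (∃ g, σ g ≠ g) ∧
      ∀ c : F, ∃ b, b * σ b = algebraMap F L c := by
  have := Fintype.ofFinite F
  have := Fintype.ofFinite L
  have hq : 2 ≤ Fintype.card F := Fintype.one_lt_card
  have hcard : Fintype.card L = Fintype.card F ^ 2 := by
    rw [Module.card_eq_pow_finrank (K := F), hL]
  refine ⟨FiniteField.frobeniusAlgHom F L, fun x ↦ ?_, ?_, fun c ↦ ?_⟩
  · simp only [FiniteField.coe_frobeniusAlgHom]
    rw [← pow_mul, ← sq, ← hcard, FiniteField.pow_card]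
  · by_contra! h
    have h1 : FiniteField.frobeniusAlgHom F L = 1 := AlgHom.ext h
    have h2 := FiniteField.orderOf_frobeniusAlgHom F L
    rw [h1, orderOf_one, hL] at h2
    omega
  · obtain ⟨b, rfl⟩ := FiniteField.norm_surjective F L c
    refine ⟨b, ?_⟩
    rw [FiniteField.algebraMap_norm_eq_pow, FiniteField.coe_frobeniusAlgHom, ← pow_succ',
      Nat.card_eq_fintype_card, Nat.card_eq_fintype_card, hcard]
    congr 1
    symm
    apply Nat.div_eq_of_eq_mul_left (by omega)
    obtain ⟨t, ht⟩ := Nat.exists_eq_add_of_le hq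
    rw [ht, Nat.sub_eq_iff_eq_add (Nat.one_le_pow _ _ (by omega)),
      show 2 + t - 1 = 1 + t by omega]
    ring

variable (σ : L →ₐ[F] L) {g : L} (hg : σ g ≠ g)

include hg in
theorem exists_eq_add_smul (hL : finrank F L = 2) (x : L) :
    ∃ s t : F, x = algebraMap F L s + t • g := by
  have hli : LinearIndependent F ![(1 : L), g] := by
    rw [LinearIndependent.pair_iff]
    intro s t h
    have h2 := congrArg σ h
    simp only [map_add, map_smul, map_one, map_zero] at h2
    have h3 : t • (σ g - g) = 0 := by
      rw [smul_sub, sub_eq_zero]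
      exact add_left_cancel (h2.trans h.symm)
    have ht : t = 0 := (smul_eq_zero.1 h3).resolve_right (sub_ne_zero.2 hg)
    refine ⟨?_, ht⟩
    rw [ht, zero_smul, add_zero] at h
    exact (smul_eq_zero.1 h).resolve_right one_ne_zero
  have hspan := hli.span_eq_top_of_card_eq_finrank' (by simp [hL])
  have hx : x ∈ Submodule.span F (Set.range ![(1 : L), g]) := by
    rw [hspan]; trivial
  rw [Matrix.range_cons, Matrix.range_cons, Matrix.range_empty, Set.union_empty,
    Set.singleton_union, Submodule.mem_span_pair] at hx
  obtain ⟨s, t, h⟩ := hx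
  exact ⟨s, t, by rw [← h, Algebra.algebraMap_eq_smul_one]⟩

include hg in
theorem exists_algebraMap_eq_of_fixed (hL : finrank F L = 2) {x : L} (hx : σ x = x) :
    ∃ s : F, algebraMap F L s = x := by
  obtain ⟨s, t, rfl⟩ := exists_eq_add_smul σ hg hL x
  have h3 : t • (σ g - g) = 0 := by
    rw [smul_sub, sub_eq_zero]
    simpa using hx
  have ht : t = 0 := (smul_eq_zero.1 h3).resolve_right (sub_ne_zero.2 hg)
  exact ⟨s, by simp [ht]⟩

variable [Finite F]

include hg in
/-- An affine line over `F` in `L` on which the norm does not take a certain nonzero value. -/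
theorem exists_norm_avoiding (hL : finrank F L = 2) (hσ : ∀ x, σ (σ x) = x)
    (hnorm : ∀ c : F, ∃ b, b * σ b = algebraMap F L c) (hF : Nat.card F ≠ 2) :
    ∃ a b : L, b ≠ 0 ∧ ∀ s : F,
      (algebraMap F L s + a) * (algebraMap F L s + σ a) ≠ b * σ b := by
  have := Fintype.ofFinite F
  have hinj := (algebraMap F L).injective
  by_cases hchar : ringChar F = 2
  · have h2 : CharP F 2 := hchar ▸ ringChar.charP F
    have h2L : CharP L 2 := charP_of_injective_algebraMap hinj 2
    -- In characteristic 2, an element `a` of trace 1 has `N(s + a) = h s + N(a)`. The map `h` is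
    -- additive and not injective, hence misses some value `d`.
    let h : F → F := fun s ↦ s ^ 2 + s
    have hadd : ∀ s t, h (s + t) = h s + h t := fun s t ↦ by
      simp only [h, CharTwo.add_sq]; ring
    have hns : ¬ Function.Surjective h := by
      rw [← Finite.injective_iff_surjective]
      intro hi
      have : h 0 = h 1 := by simp [h, CharTwo.add_self_eq_zero]
      exact zero_ne_one (hi this)
    obtain ⟨d, hd⟩ := not_forall.1 hns
    obtain ⟨s₀, hs₀, hs₁⟩ : ∃ s₀ : F, s₀ ≠ 0 ∧ s₀ ≠ 1 := by
      by_contra! hc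
      apply hF
      classical
      have : (Finset.univ : Finset F) = {0, 1} := by
        ext x
        simpa [or_iff_not_imp_left] using hc x
      rw [Nat.card_eq_fintype_card, ← Finset.card_univ, this]
      exact Finset.card_pair zero_ne_one
    have hh₀ : h s₀ ≠ 0 := by
      have : h s₀ = s₀ * (s₀ + 1) := by simp only [h]; ring
      rw [this]
      refine mul_ne_zero hs₀ fun hc ↦ hs₁ ?_
      rwa [CharTwo.add_eq_zero] at hc
    obtain ⟨t, ht⟩ := exists_algebraMap_eq_of_fixed σ hg hL (x := g + σ g)
      (by rw [map_add, hσ, add_comm])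
    have ht0 : g + σ g ≠ 0 := by
      rw [Ne, CharTwo.add_eq_zero]
      exact fun hc ↦ hg hc.symm
    let a := g / (g + σ g)
    have hσa : a + σ a = 1 := by
      simp only [a, map_div₀]
      rw [map_add, hσ, add_comm (σ g) g, ← add_div, div_self ht0]
    obtain ⟨n, hn⟩ := exists_algebraMap_eq_of_fixed σ hg hL (x := a * σ a)
      (by rw [map_mul, hσ, mul_comm])
    have key : ∀ s : F, (algebraMap F L s + a) * (algebraMap F L s + σ a) =
        algebraMap F L (h s + n) := by
      intro s
      have : (algebraMap F L s + a) * (algebraMap F L s + σ a) =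
        algebraMap F L s ^ 2 + algebraMap F L s * (a + σ a) + a * σ a := by ring
      rw [this, hσa, ← hn]
      simp [h]
    have hfin : ∀ c : F, c ≠ 0 → (∀ s, h s + n ≠ c) → ∃ a b : L, b ≠ 0 ∧ ∀ s : F,
        (algebraMap F L s + a) * (algebraMap F L s + σ a) ≠ b * σ b := by
      intro c hc hsc
      obtain ⟨b, hb⟩ := hnorm c
      refine ⟨a, b, ?_, fun s ↦ ?_⟩
      · rintro rfl
        rw [zero_mul] at hb
        exact hc (hinj (by rw [← hb, map_zero]))
      · rw [key, hb]
        exact fun hc ↦ hsc s (hinj hc)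
    -- The avoided norm must be nonzero. If `d + n` vanishes, `d` is shifted by a nonzero value `h
    -- s₀`, which stays outside the image of `h`; such an `s₀` exists because `q > 2`.
    by_cases hc : d + n = 0
    · refine hfin (d + n + h s₀) (by rw [hc, zero_add]; exact hh₀) fun s hs ↦ hd ⟨s + s₀, ?_⟩
      rw [hadd]
      have : h s = d + h s₀ := by linear_combination hs
      rw [this, add_assoc, CharTwo.add_self_eq_zero, add_zero]
    · exact hfin (d + n) hc fun s hs ↦ hd ⟨s, add_right_cancel hs⟩
  -- In odd characteristic take `a = 0`: the norms of elements of `F` are squares, so a nonsquare is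
  -- avoided.
  · obtain ⟨c, hc⟩ := FiniteField.exists_nonsquare hchar
    obtain ⟨b, hb⟩ := hnorm c
    refine ⟨0, b, ?_, fun s hs ↦ hc ⟨s, ?_⟩⟩
    · rintro rfl
      rw [zero_mul] at hb
      have : c = 0 := hinj (by rw [← hb, map_zero])
      exact hc (this ▸ ⟨0, by simp⟩)
    · rw [map_zero, add_zero, hb, ← map_mul] at hs
      exact (hinj hs).symm

include hg in
-- A nonzero solution `u` of `(s + a) u = -b σ(u)` would force `N(s + a) = N(b)` on taking norms.
theorem exists_spread_parameters (hL : finrank F L = 2) (hσ : ∀ x, σ (σ x) = x)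
    (hnorm : ∀ c : F, ∃ b, b * σ b = algebraMap F L c) (hF : Nat.card F ≠ 2) :
    ∃ a b : L, b ≠ 0 ∧ ∀ (s : F) (u : L), u ≠ 0 → s • u + (a * u + b * σ u) ≠ 0 := by
  obtain ⟨a, b, hb, h⟩ := exists_norm_avoiding σ hg hL hσ hnorm hF
  refine ⟨a, b, hb, fun s u hu h0 ↦ h s ?_⟩
  have hσu : σ u ≠ 0 := (map_ne_zero σ).2 hu
  have h1 : (algebraMap F L s + a) * u = -(b * σ u) := by
    rw [Algebra.smul_def] at h0
    linear_combination h0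
  have h2 := congrArg σ h1
  simp only [map_mul, map_add, map_neg, hσ, AlgHom.commutes] at h2
  apply mul_right_cancel₀ (mul_ne_zero hu hσu)
  linear_combination (algebraMap F L s + σ a) * σ u * h1 - b * σ u * h2

end QuadraticExtension

/-! ### A parallelism by switching reguli, for `q ≠ 2` -/

section SpreadSwitching

variable {F L : Type*} [Field F] [Field L] [Algebra F L]

/-- The line `v = a u + b σ(u)`. -/
def graphLine (σ : L →ₐ[F] L) (a b : L) : Submodule F (L × L) :=
  LinearMap.graph (LinearMap.mulLeft F a + LinearMap.mulLeft F b ∘ₗ σ.toLinearMap)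

/-- The line `u = 0`. -/
def verticalLine (F L : Type*) [Field F] [Field L] [Algebra F L] : Submodule F (L × L) :=
  LinearMap.ker (LinearMap.fst F L L)

/-- The line joining `(x, a x)` and `(0, e x)`. -/
def regulusLine (F : Type*) {L : Type*} [Field F] [Field L] [Algebra F L] (e a x : L) :
    Submodule F (L × L) :=
  Submodule.span F {(x, a * x), (0, e * x)}

theorem mem_graphLine {σ : L →ₐ[F] L} {a b : L} {v : L × L} :
    v ∈ graphLine σ a b ↔ v.2 = a * v.1 + b * σ v.1 := by
  simp [graphLine, LinearMap.mem_graph_iff]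

theorem mk_mem_graphLine (σ : L →ₐ[F] L) (a b u : L) :
    (u, a * u + b * σ u) ∈ graphLine σ a b :=
  mem_graphLine.2 rfl

theorem mem_verticalLine {v : L × L} : v ∈ verticalLine F L ↔ v.1 = 0 := by
  simp [verticalLine]

theorem mem_regulusLine {e a x : L} {v : L × L} :
    v ∈ regulusLine F e a x ↔ ∃ s t : F, v = (s • x, s • (a * x) + t • (e * x)) := by
  rw [regulusLine, Submodule.mem_span_pair]
  constructor
  · rintro ⟨s, t, rfl⟩
    exact ⟨s, t, by simp⟩
  · rintro ⟨s, t, rfl⟩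
    exact ⟨s, t, by simp⟩

theorem finrank_graphLine (hL : finrank F L = 2) (σ : L →ₐ[F] L) (a b : L) :
    finrank F (graphLine σ a b) = 2 := by
  rw [graphLine, LinearMap.graph_eq_range_prod, LinearMap.finrank_range_of_inj, hL]
  exact fun u v h ↦ congrArg Prod.fst h

theorem finrank_verticalLine (hL : finrank F L = 2) : finrank F (verticalLine F L) = 2 := by
  have : FiniteDimensional F L := Module.finite_of_finrank_pos (by omega)
  have h := LinearMap.finrank_range_add_finrank_ker (LinearMap.fst F L L)
  rw [LinearMap.range_eq_top.2 LinearMap.fst_surjective, finrank_top, finrank_prod, hL] at h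
  rw [verticalLine]
  omega

theorem finrank_regulusLine {e a x : L} (he : e ≠ 0) (hx : x ≠ 0) :
    finrank F (regulusLine F e a x) = 2 := by
  have h : LinearIndependent F ![(x, a * x), (0, e * x)] := by
    rw [LinearIndependent.pair_iff]
    intro s t h
    simp only [Prod.smul_mk, smul_zero, Prod.mk_add_mk, add_zero, Prod.mk_eq_zero] at h
    have hs : s = 0 := (smul_eq_zero.1 h.1).resolve_right hx
    refine ⟨hs, ?_⟩
    have h2 := h.2
    rw [hs, zero_smul, zero_add] at h2
    exact (smul_eq_zero.1 h2).resolve_right (mul_ne_zero he hx)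
  have := finrank_span_eq_card h
  rwa [Matrix.range_cons, Matrix.range_cons, Matrix.range_empty, Set.union_empty,
    Set.singleton_union] at this

/-- The line is the transversal through `(x, a x)` of the regulus formed by `u = 0` and the lines `v
= (a + s e) u` with `s` in `F`. That regulus depends only on `F e` and on `a` modulo `F e`. -/
theorem regulusLine_smul {c d k : F} (hc : c ≠ 0) (hk : k ≠ 0) (e a x : L) :
    regulusLine F (k • e) (a + d • e) (c • x) = regulusLine F e a x := by
  have hkc : k * c ≠ 0 := mul_ne_zero hk hc
  have hck : algebraMap F L c ≠ 0 ∧ algebraMap F L k ≠ 0 := by simp [hc, hk]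
  ext v
  simp only [mem_regulusLine]
  constructor
  · rintro ⟨s, t, rfl⟩
    refine ⟨s * c, s * c * d + t * k * c, ?_⟩
    ext
    · simp [mul_smul]
    · simp only [Algebra.smul_def, map_mul, map_add]; ring
  · rintro ⟨s, t, rfl⟩
    refine ⟨s / c, (t - s * d) / (k * c), ?_⟩
    ext
    · rw [smul_smul, div_mul_cancel₀ _ hc]
    · have := hck.1
      have := hck.2
      simp only [Algebra.smul_def, map_mul, map_div₀, map_sub]
      field_simp
      ring

/-- Representatives, up to scalars, of the nonzero elements of `L`. -/
def projRep (g : L) : Option F → L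
  | none => 1
  | some s => algebraMap F L s + g

theorem exists_smul_projRep {g : L} (hspan : ∀ x : L, ∃ s t : F, x = algebraMap F L s + t • g)
    {x : L} (hx : x ≠ 0) : ∃ (c : F) (o : Option F), c ≠ 0 ∧ x = c • projRep g o := by
  obtain ⟨s, t, rfl⟩ := hspan x
  by_cases ht : t = 0
  · subst ht
    refine ⟨s, none, ?_, ?_⟩
    · rintro rfl
      simp at hx
    · simp [projRep, Algebra.smul_def]
  · refine ⟨t, some (s / t), ht, ?_⟩
    rw [projRep, smul_add, Algebra.smul_def t (algebraMap F L (s / t)), ← map_mul,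
      mul_div_cancel₀ _ ht]

theorem projRep_ne_zero {σ : L →ₐ[F] L} {g : L} (hg : σ g ≠ g) (o : Option F) :
    projRep g o ≠ 0 := by
  cases o with
  | none => exact one_ne_zero
  | some s =>
    intro h
    apply hg
    have h1 : g = -algebraMap F L s := by rw [projRep] at h; linear_combination h
    rw [h1]
    simp

open Classical in
/-- The classes of the parallelism: a regular spread, and the spreads that arise from regular ones
through `verticalLine` by switching the regulus shared with the first spread. -/
noncomputable def switchedSpread [Fintype F] [Fintype L] (σ : L →ₐ[F] L) (g al be : L) :
    Option ({e : L // e ≠ 0} × L) → Finset (Submodule F (L × L))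
  | none => insert (verticalLine F L) (Finset.univ.image fun a ↦ graphLine σ a 0)
  | some (e, a) =>
    (Finset.univ.image fun p : F × Fˣ ↦
      graphLine σ (a + (p.1 • e.1 + (p.2 : F) • (al * e.1))) ((p.2 : F) • (be * e.1))) ∪
    (Finset.univ.image fun o : Option F ↦ regulusLine F e.1 a (projRep g o))

theorem card_switchedSpread_le [Fintype F] [Fintype L] (hL : finrank F L = 2) (σ : L →ₐ[F] L)
    (g al be : L) (i) : (switchedSpread σ g al be i).card ≤ Nat.card F ^ 2 + 1 := by
  classical
  rw [Nat.card_eq_fintype_card]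
  have hq : 2 ≤ Fintype.card F := Fintype.one_lt_card
  match i with
  | none =>
    refine (Finset.card_insert_le _ _).trans (Nat.succ_le_succ (Finset.card_image_le.trans ?_))
    rw [Finset.card_univ, Module.card_eq_pow_finrank (K := F), hL]
  | some (e, a) =>
    refine (Finset.card_union_le _ _).trans
      ((add_le_add Finset.card_image_le Finset.card_image_le).trans ?_)
    rw [Finset.card_univ, Finset.card_univ, Fintype.card_prod, Fintype.card_units,
      Fintype.card_option]
    -- The count is `q (q - 1)` graphs plus `q + 1` switched lines.
    obtain ⟨t, ht⟩ := Nat.exists_eq_add_of_le hq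
    rw [ht, show 2 + t - 1 = 1 + t by omega]
    exact le_of_eq (by ring)

section

variable [Fintype F] [Fintype L] {σ : L →ₐ[F] L} {g al be : L}
  (hspan : ∀ x : L, ∃ s t : F, x = algebraMap F L s + t • g) (hg : σ g ≠ g)
include hspan hg

theorem mem_switchedSpread_some {e : {e : L // e ≠ 0}} {a : L} {l : Submodule F (L × L)} :
    l ∈ switchedSpread σ g al be (some (e, a)) ↔
      (∃ s t : F, t ≠ 0 ∧ l = graphLine σ (a + (s • e.1 + t • (al * e.1))) (t • (be * e.1))) ∨
      ∃ x, x ≠ 0 ∧ l = regulusLine F e.1 a x := by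
  simp only [switchedSpread, Finset.mem_union, Finset.mem_image, Finset.mem_univ, true_and]
  refine or_congr ⟨?_, ?_⟩ ⟨?_, ?_⟩
  · rintro ⟨⟨s, t⟩, rfl⟩
    exact ⟨s, t, t.ne_zero, rfl⟩
  · rintro ⟨s, t, ht, rfl⟩
    exact ⟨⟨s, Units.mk0 t ht⟩, rfl⟩
  · rintro ⟨o, rfl⟩
    exact ⟨_, projRep_ne_zero hg o, rfl⟩
  · rintro ⟨x, hx, rfl⟩
    obtain ⟨c, o, hc, rfl⟩ := exists_smul_projRep hspan hx
    refine ⟨o, ?_⟩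
    simpa using (regulusLine_smul (k := 1) (d := 0) hc one_ne_zero e.1 a (projRep g o)).symm

omit hspan hg in
theorem mem_switchedSpread_none {l : Submodule F (L × L)} :
    l ∈ switchedSpread σ g al be none ↔ l = verticalLine F L ∨ ∃ a, l = graphLine σ a 0 := by
  simp [switchedSpread, eq_comm]

theorem finrank_of_mem_switchedSpread (hL : finrank F L = 2) (i) {l : Submodule F (L × L)}
    (hl : l ∈ switchedSpread σ g al be i) : finrank F l = 2 := by
  match i with
  | none =>
    obtain rfl | ⟨a, rfl⟩ := mem_switchedSpread_none.1 hl
    · exact finrank_verticalLine hL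
    · exact finrank_graphLine hL σ a 0
  | some (e, a) =>
    obtain ⟨s, t, -, rfl⟩ | ⟨x, hx, rfl⟩ := (mem_switchedSpread_some hspan hg).1 hl
    · exact finrank_graphLine hL σ _ _
    · exact finrank_regulusLine e.2 hx

/-- For `u ≠ 0`, `hpar` says that `u` and `al * u + be * σ u` are independent over `F`. Hence the
graphs with parameters `(s, t)` meet each fiber over `u` in every point exactly once. -/
theorem exists_mem_switchedSpread (hL : finrank F L = 2)
    (hpar : ∀ (s : F) (u : L), u ≠ 0 → s • u + (al * u + be * σ u) ≠ 0) (i) (v : L × L) :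
    ∃ l ∈ switchedSpread σ g al be i, v ∈ l := by
  obtain ⟨u, v⟩ := v
  match i with
  | none =>
    by_cases hu : u = 0
    · exact ⟨_, mem_switchedSpread_none.2 (Or.inl rfl), mem_verticalLine.2 hu⟩
    · exact ⟨_, mem_switchedSpread_none.2 (Or.inr ⟨v / u, rfl⟩),
        mem_graphLine.2 (by simp [div_mul_cancel₀ _ hu])⟩
  | some (⟨e, he⟩, a) =>
    simp only [mem_switchedSpread_some hspan hg]
    by_cases hu : u = 0
    · by_cases hv : v = 0
      · exact ⟨_, Or.inr ⟨1, one_ne_zero, rfl⟩, by rw [hu, hv]; exact Submodule.zero_mem _⟩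
      · exact ⟨_, Or.inr ⟨v / e, div_ne_zero hv he, rfl⟩, mem_regulusLine.2 ⟨0, 1, by
          simp [hu, mul_div_cancel₀ _ he]⟩⟩
    · let f : F × F →ₗ[F] L :=
        LinearMap.coprod (LinearMap.toSpanSingleton F L (u * e))
          (LinearMap.toSpanSingleton F L ((al * u + be * σ u) * e))
      have hf : ∀ s t, f (s, t) = s • (u * e) + t • ((al * u + be * σ u) * e) := fun s t ↦ by
        simp [f]
      have : FiniteDimensional F L := Module.finite_of_finrank_pos (by omega)
      have hsurj : Function.Surjective f := by
        rw [← LinearMap.injective_iff_surjective_of_finrank_eq_finrank (by simp [hL]),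
          injective_iff_map_eq_zero]
        rintro ⟨s, t⟩ h
        rw [hf] at h
        have h1 : s • u + t • (al * u + be * σ u) = 0 := by
          apply mul_right_cancel₀ he
          rw [zero_mul, ← h, add_mul, smul_mul_assoc, smul_mul_assoc]
        by_cases ht : t = 0
        · rw [ht, zero_smul, add_zero] at h1
          rw [(smul_eq_zero.1 h1).resolve_right hu, ht]
          rfl
        · refine absurd ?_ (hpar (t⁻¹ * s) u hu)
          rw [mul_smul, ← inv_smul_smul₀ ht (al * u + be * σ u), ← smul_add, h1, smul_zero]
      obtain ⟨⟨s, t⟩, hst⟩ := hsurj (v - a * u)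
      rw [hf] at hst
      -- For `t = 0` the point lies on the line `v = (a + s e) u` of the removed regulus, so the
      -- line of the opposite regulus through it is used.
      by_cases ht : t = 0
      · refine ⟨_, Or.inr ⟨u, hu, rfl⟩, mem_regulusLine.2 ⟨1, s, ?_⟩⟩
        ext
        · simp
        · rw [ht, zero_smul, add_zero, mul_comm] at hst
          simp [hst]
      · refine ⟨_, Or.inl ⟨s, t, ht, rfl⟩, mem_graphLine.2 ?_⟩
        simp only [Algebra.smul_def] at hst ⊢
        linear_combination -hst

/-- A line equals the vertical line, meets it in a point, or is disjoint from it. In the second case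
it is a switched line; in the third it is the graph of an `F`-linear map of `L`, which has the form
`a u + b σ(u)`. -/
theorem exists_switchedSpread_mem (hL : finrank F L = 2) (hbe : be ≠ 0) (l : Submodule F (L × L))
    (hl : finrank F l = 2) : ∃ i, l ∈ switchedSpread σ g al be i := by
  have hfd : FiniteDimensional F L := Module.finite_of_finrank_pos (by omega)
  by_cases h0 : l = verticalLine F L
  · exact ⟨none, mem_switchedSpread_none.2 (Or.inl h0)⟩
  by_cases hv : ∃ v, v ≠ 0 ∧ (0, v) ∈ l
  · obtain ⟨v, hv, hvl⟩ := hv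
    obtain ⟨u, w, huw, hu⟩ : ∃ u w, (u, w) ∈ l ∧ u ≠ 0 := by
      by_contra! h
      refine h0 (Submodule.eq_of_le_of_finrank_eq (fun x hx ↦ ?_)
        (by rw [hl, finrank_verticalLine hL]))
      exact mem_verticalLine.2 (h x.1 x.2 hx)
    refine ⟨some (⟨v / u, div_ne_zero hv hu⟩, w / u),
      (mem_switchedSpread_some hspan hg).2 (Or.inr ⟨u, hu, ?_⟩)⟩
    symm
    refine Submodule.eq_of_le_of_finrank_eq ?_
      (by rw [hl, finrank_regulusLine (div_ne_zero hv hu) hu])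
    rw [regulusLine, Submodule.span_le]
    rintro x (rfl | rfl)
    · simpa [div_mul_cancel₀ _ hu] using huw
    · simpa [div_mul_cancel₀ _ hu] using hvl
  · push Not at hv
    have hker : LinearMap.ker ((LinearMap.fst F L L).domRestrict l) = ⊥ := by
      rw [LinearMap.ker_eq_bot']
      rintro ⟨⟨x, y⟩, hxy⟩ hx
      have hx0 : x = 0 := hx
      subst hx0
      have : y = 0 := by
        by_contra hy
        exact hv y hy hxy
      simp [this]
    have hsurj : Function.Surjective ((LinearMap.fst F L L).domRestrict l) :=
      (LinearMap.injective_iff_surjective_of_finrank_eq_finrank (by rw [hl, hL])).1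
        (LinearMap.ker_eq_bot.1 hker)
    obtain ⟨⟨⟨x₁, v₁⟩, h₁⟩, e₁⟩ := hsurj 1
    obtain ⟨⟨⟨x₂, v₂⟩, h₂⟩, e₂⟩ := hsurj g
    obtain rfl : x₁ = 1 := e₁
    obtain rfl : x₂ = g := e₂
    have hd : σ x₂ - x₂ ≠ 0 := sub_ne_zero.2 hg
    -- The solution of `a + b = v₁` and `a g + b σ(g) = v₂`, the prescribed values at `1` and `g`.
    let b := (v₂ - v₁ * x₂) / (σ x₂ - x₂)
    have hb : b * (σ x₂ - x₂) = v₂ - v₁ * x₂ := div_mul_cancel₀ _ hd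
    have hlb : l = graphLine σ (v₁ - b) b := by
      symm
      refine Submodule.eq_of_le_of_finrank_eq ?_ (by rw [hl, finrank_graphLine hL])
      rintro ⟨x, y⟩ hxy
      replace hxy : y = (v₁ - b) * x + b * σ x := mem_graphLine.1 hxy
      obtain ⟨s, t, rfl⟩ := hspan x
      have : (algebraMap F L s + t • x₂, y) = s • ((1 : L), v₁) + t • (x₂, v₂) := by
        ext
        · simp [Algebra.smul_def]
        · simp only [hxy, map_add, map_smul, AlgHom.commutes, Prod.snd_add, Prod.smul_snd]
          simp only [Algebra.smul_def]
          linear_combination algebraMap F L t * hb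
      rw [this]
      exact l.add_mem (l.smul_mem s h₁) (l.smul_mem t h₂)
    by_cases hb0 : b = 0
    · exact ⟨none, mem_switchedSpread_none.2 (Or.inr ⟨_, by rw [hlb, hb0]⟩)⟩
    · refine ⟨some (⟨b / be, div_ne_zero hb0 hbe⟩, v₁ - b - al * (b / be)),
        (mem_switchedSpread_some hspan hg).2 (Or.inl ⟨0, 1, one_ne_zero, ?_⟩)⟩
      rw [hlb]
      simp [mul_div_cancel₀ _ hbe]

theorem switchedSpread_eq_of_smul {e e' : {e : L // e ≠ 0}} {a a' : L} {c d : F} (hc : c ≠ 0)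
    (he : e'.1 = c • e.1) (ha : a' = a + d • e.1) :
    switchedSpread σ g al be (some (e, a)) = switchedSpread σ g al be (some (e', a')) := by
  obtain ⟨e, he0⟩ := e
  obtain ⟨e', he0'⟩ := e'
  simp only at he ha
  subst he ha
  have hc' : algebraMap F L c ≠ 0 := by simpa using hc
  ext l
  simp only [mem_switchedSpread_some hspan hg]
  refine or_congr ⟨?_, ?_⟩ ⟨?_, ?_⟩
  · rintro ⟨s, t, ht, rfl⟩
    refine ⟨(s - d) / c, t / c, div_ne_zero ht hc, ?_⟩
    congr 1 <;>
    · simp only [Algebra.smul_def, map_div₀, map_sub]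
      field_simp
      try ring
  · rintro ⟨s, t, ht, rfl⟩
    refine ⟨d + s * c, t * c, mul_ne_zero ht hc, ?_⟩
    congr 1 <;>
    · simp only [Algebra.smul_def, map_mul, map_add]
      ring
  · rintro ⟨x, hx, rfl⟩
    refine ⟨x, hx, ?_⟩
    simpa using (regulusLine_smul (c := 1) (d := d) one_ne_zero hc e a x).symm
  · rintro ⟨x, hx, rfl⟩
    refine ⟨x, hx, ?_⟩
    simpa using regulusLine_smul (c := 1) (d := d) one_ne_zero hc e a x

omit [Fintype F] [Fintype L] hspan hg in
theorem graphLine_ne_regulusLine {e x : L} (he : e ≠ 0) (hx : x ≠ 0) (a a' b' : L) :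
    graphLine σ a' b' ≠ regulusLine F e a x := by
  intro h
  have h1 : ((0 : L), e * x) ∈ regulusLine F e a x := mem_regulusLine.2 ⟨0, 1, by simp⟩
  rw [← h, mem_graphLine] at h1
  simp [he, hx] at h1

omit [Fintype F] [Fintype L] hspan in
theorem graphLine_injective {a b a' b' : L} (h : graphLine σ a b = graphLine σ a' b') :
    a = a' ∧ b = b' := by
  have h1 : ∀ u, a * u + b * σ u = a' * u + b' * σ u := fun u ↦ by
    have : (u, a * u + b * σ u) ∈ graphLine σ a' b' := h ▸ mem_graphLine.2 rfl
    exact mem_graphLine.1 this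
  have h2 := h1 1
  rw [map_one] at h2
  have h3 : (b - b') * (σ g - g) = 0 := by linear_combination h1 g - g * h2
  have hb : b = b' :=
    sub_eq_zero.1 ((mul_eq_zero.1 h3).resolve_right (sub_ne_zero.2 hg))
  exact ⟨by linear_combination h2 - hb, hb⟩

theorem switchedSpread_none_some_disjoint (hbe : be ≠ 0) {p : {e : L // e ≠ 0} × L}
    {l : Submodule F (L × L)} (hl : l ∈ switchedSpread σ g al be none)
    (hl' : l ∈ switchedSpread σ g al be (some p)) : False := by
  obtain ⟨⟨e, he⟩, a⟩ := p
  obtain ⟨s, t, ht, rfl⟩ | ⟨x, hx, rfl⟩ := (mem_switchedSpread_some hspan hg).1 hl'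
  · obtain h | ⟨a', h⟩ := mem_switchedSpread_none.1 hl
    · have hy := mk_mem_graphLine σ (a + (s • e + t • (al * e))) (t • (be * e)) 1
      rw [h] at hy
      exact one_ne_zero (mem_verticalLine.1 hy)
    · have := (graphLine_injective hg h).2
      simp [ht, hbe, he] at this
  · obtain h | ⟨a', h⟩ := mem_switchedSpread_none.1 hl
    · have h1 : (x, a * x) ∈ regulusLine F e a x := mem_regulusLine.2 ⟨1, 0, by simp⟩
      rw [h] at h1
      exact hx (mem_verticalLine.1 h1)
    · exact graphLine_ne_regulusLine he hx a a' 0 h.symm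

theorem switchedSpread_eq_of_mem (hbe : be ≠ 0) (i j) (l : Submodule F (L × L))
    (hi : l ∈ switchedSpread σ g al be i) (hj : l ∈ switchedSpread σ g al be j) :
    switchedSpread σ g al be i = switchedSpread σ g al be j := by
  match i, j with
  | none, none => rfl
  | none, some p => exact (switchedSpread_none_some_disjoint hspan hg hbe hi hj).elim
  | some p, none => exact (switchedSpread_none_some_disjoint hspan hg hbe hj hi).elim
  | some (⟨e, he⟩, a), some (⟨e', he'⟩, a') =>
    obtain ⟨s, t, ht, rfl⟩ | ⟨x, hx, rfl⟩ := (mem_switchedSpread_some hspan hg).1 hi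
    · obtain ⟨s', t', ht', h⟩ | ⟨x', hx', h⟩ := (mem_switchedSpread_some hspan hg).1 hj
      · obtain ⟨h1, h2⟩ := graphLine_injective hg h
        simp only [Algebra.smul_def] at h1 h2
        have ht1 : algebraMap F L t' ≠ 0 := by simpa using ht'
        have hte : algebraMap F L t * e = algebraMap F L t' * e' := by
          apply mul_right_cancel₀ hbe
          linear_combination h2
        have hee : e' = (t / t') • e := by
          rw [Algebra.smul_def, map_div₀]
          field_simp
          linear_combination -hte
        -- Comparing coefficients of `σ` gives `t e = t' e'`; the coefficients of the identity then
        -- give `a' - a` as the multiple `d` of `e`.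
        refine switchedSpread_eq_of_smul hspan hg (c := t / t') (d := s - s' * (t / t'))
          (div_ne_zero ht ht') hee ?_
        simp only [Algebra.smul_def, map_sub, map_mul] at hee ⊢
        linear_combination -h1 + al * hte - algebraMap F L s' * hee
      · exact (graphLine_ne_regulusLine he' hx' _ _ _ h).elim
    · obtain ⟨s', t', ht', h⟩ | ⟨x', hx', h⟩ := (mem_switchedSpread_some hspan hg).1 hj
      · exact (graphLine_ne_regulusLine he hx _ _ _ h.symm).elim
      · have h1 : (x, a * x) ∈ regulusLine F e a x := mem_regulusLine.2 ⟨1, 0, by simp⟩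
        have h2 : (0, e * x) ∈ regulusLine F e a x := mem_regulusLine.2 ⟨0, 1, by simp⟩
        simp only at h
        rw [h] at h1 h2
        -- Both generators of the first line are expressed in those of the second; the four
        -- resulting equations show that `e'` and `a' - a` are `F`-multiples of `e`.
        obtain ⟨s, t, h1⟩ := mem_regulusLine.1 h1
        obtain ⟨s', t', h2⟩ := mem_regulusLine.1 h2
        rw [Prod.mk.injEq] at h1 h2
        obtain ⟨hxs, h1⟩ := h1
        obtain ⟨hs', h2⟩ := h2
        have hs0 : s ≠ 0 := by
          rintro rfl
          rw [zero_smul] at hxs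
          exact hx hxs
        have hs'0 : s' = 0 := (smul_eq_zero.1 hs'.symm).resolve_right hx'
        rw [hs'0, zero_smul, zero_add] at h2
        have ht'0 : t' ≠ 0 := by
          rintro rfl
          rw [zero_smul] at h2
          exact mul_ne_zero he hx h2
        have hsL : algebraMap F L s ≠ 0 := by simpa using hs0
        have htL : algebraMap F L t' ≠ 0 := by simpa using ht'0
        simp only [Algebra.smul_def] at hxs h1 h2
        have h3 : e' * algebraMap F L t' = algebraMap F L s * e := by
          apply mul_right_cancel₀ hx'
          linear_combination -h2 + e * hxs
        have h4 : algebraMap F L s * (a' - a) = -(algebraMap F L t * e') := by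
          apply mul_right_cancel₀ hx'
          linear_combination -h1 + a * hxs
        have h5 : algebraMap F L t' * (a' - a) = -(algebraMap F L t * e) := by
          apply mul_left_cancel₀ hsL
          linear_combination algebraMap F L t' * h4 - algebraMap F L t * h3
        refine switchedSpread_eq_of_smul hspan hg (c := s / t') (d := -(t / t'))
          (div_ne_zero hs0 ht'0) ?_ ?_
        · rw [Algebra.smul_def, map_div₀]
          field_simp
          linear_combination h3
        · rw [Algebra.smul_def, map_neg, map_div₀]
          field_simp
          linear_combination h5

end

end SpreadSwitching

theorem exists_isParallelRel_of_natCard_ne_two {F M : Type*} [Field F] [Finite F] [AddCommGroup M]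
    [Module F M] (hM : finrank F M = 4) (hF : Nat.card F ≠ 2) :
    ∃ r : Submodule F M → Submodule F M → Prop, IsParallelRel F r := by
  obtain ⟨L, _, _, _, hL⟩ := exists_extension_field F two_ne_zero
  have := Fintype.ofFinite F
  have := Fintype.ofFinite L
  obtain ⟨σ, hσ, ⟨g, hg⟩, hnorm⟩ := exists_involution_of_finrank_eq_two hL
  obtain ⟨al, be, hbe, hpar⟩ := exists_spread_parameters σ hg hL hσ hnorm hF
  have hspan := exists_eq_add_smul σ hg hL
  obtain ⟨r, hr⟩ := exists_isParallelRel_of_family (switchedSpread σ g al be)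
    (card_switchedSpread_le hL σ g al be)
    (fun i l hl ↦ finrank_of_mem_switchedSpread hspan hg hL i hl)
    (exists_mem_switchedSpread hspan hg hL hpar)
    (exists_switchedSpread_mem hspan hg hL hbe)
    (switchedSpread_eq_of_mem hspan hg hbe)
  have : FiniteDimensional F M := Module.finite_of_finrank_pos (by omega)
  let e : M ≃ₗ[F] L × L := LinearEquiv.ofFinrankEq _ _ (by rw [finrank_prod, hL, hM])
  exact ⟨_, hr.map_equiv e⟩

/-! ### A parallelism of `PG(3, 2)`, checked by computation -/

section OrderTwo

/-- A collineation of order `7` of `PG(3, 2)`. -/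
def singerMap (v : ZMod 2 × ZMod 2 × ZMod 2 × ZMod 2) : ZMod 2 × ZMod 2 × ZMod 2 × ZMod 2 :=
  (v.2.2.1, v.1 + v.2.2.1, v.2.1, v.2.2.2)

/-- Generators of the lines of a spread of `PG(3, 2)` whose images under `singerMap` form a
parallelism. -/
def baseSpread : Fin 5 → Fin 2 → ZMod 2 × ZMod 2 × ZMod 2 × ZMod 2 :=
  ![![(1, 1, 1, 0), (1, 1, 0, 1)], ![(0, 1, 1, 0), (1, 0, 0, 1)], ![(1, 0, 1, 0), (0, 0, 0, 1)],
    ![(1, 0, 0, 0), (0, 1, 0, 0)], ![(0, 0, 1, 0), (0, 1, 0, 1)]]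

def spreadGen (i : Fin 7) (j : Fin 5) (k : Fin 2) : ZMod 2 × ZMod 2 × ZMod 2 × ZMod 2 :=
  singerMap^[i] (baseSpread j k)

/-- Membership in the line generated by the `j`-th pair of generators of the `i`-th spread. -/
def OnLine (i : Fin 7) (j : Fin 5) (x : ZMod 2 × ZMod 2 × ZMod 2 × ZMod 2) : Prop :=
  x = 0 ∨ x = spreadGen i j 0 ∨ x = spreadGen i j 1 ∨ x = spreadGen i j 0 + spreadGen i j 1

instance (i : Fin 7) (j : Fin 5) (x : ZMod 2 × ZMod 2 × ZMod 2 × ZMod 2) :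
    Decidable (OnLine i j x) :=
  inferInstanceAs (Decidable (_ ∨ _))

theorem exists_onLine : ∀ i x, ∃ j, OnLine i j x := by decide +kernel

theorem exists_onLine_pair : ∀ x y, x ≠ 0 → y ≠ 0 → x ≠ y →
    ∃ i j, OnLine i j x ∧ OnLine i j y := by decide +kernel

/-- Distinct spreads of the orbit share no line. Together with the two checks above, this says that
the seven spreads partition the lines. -/
theorem eq_of_onLine : ∀ i i' j j', OnLine i j (spreadGen i' j' 0) →
    OnLine i j (spreadGen i' j' 1) → i = i' := by decide +kernel

theorem spreadGen_ne : ∀ i j, spreadGen i j 0 ≠ 0 ∧ spreadGen i j 1 ≠ 0 ∧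
    spreadGen i j 0 ≠ spreadGen i j 1 := by decide +kernel

variable {F M : Type*} [Field F] [Finite F] [AddCommGroup M] [Module F M]

theorem eq_zero_or_one_of_natCard_eq_two (hF : Nat.card F = 2) (s : F) : s = 0 ∨ s = 1 := by
  classical
  have := Fintype.ofFinite F
  have h : ({0, 1} : Finset F) = Finset.univ := by
    apply Finset.eq_univ_of_card
    rw [Finset.card_pair zero_ne_one, ← hF, Nat.card_eq_fintype_card]
  have := Finset.mem_univ s
  rw [← h] at this
  simpa using this

theorem mem_span_pair_of_natCard_eq_two (hF : Nat.card F = 2) {a b x : M} :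
    x ∈ Submodule.span F {a, b} ↔ x = 0 ∨ x = a ∨ x = b ∨ x = a + b := by
  rw [Submodule.mem_span_pair]
  constructor
  · rintro ⟨s, t, rfl⟩
    obtain rfl | rfl := eq_zero_or_one_of_natCard_eq_two hF s <;>
    obtain rfl | rfl := eq_zero_or_one_of_natCard_eq_two hF t <;> simp
  · rintro (rfl | rfl | rfl | rfl)
    · exact ⟨0, 0, by simp⟩
    · exact ⟨1, 0, by simp⟩
    · exact ⟨0, 1, by simp⟩
    · exact ⟨1, 1, by simp⟩

theorem finrank_span_pair_of_natCard_eq_two (hF : Nat.card F = 2) {a b : M} (ha : a ≠ 0)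
    (hb : b ≠ 0) (hab : a ≠ b) : finrank F (Submodule.span F {a, b}) = 2 := by
  have h : LinearIndependent F ![a, b] := by
    rw [LinearIndependent.pair_iff]
    intro s t h
    have h2 : (1 : F) + 1 = 0 := by
      obtain h | h := eq_zero_or_one_of_natCard_eq_two hF ((1 : F) + 1)
      · exact h
      · simp at h
    obtain rfl | rfl := eq_zero_or_one_of_natCard_eq_two hF s <;>
    obtain rfl | rfl := eq_zero_or_one_of_natCard_eq_two hF t
    · simp
    · simp [hb] at h
    · simp [ha] at h
    · have h3 : (1 : F) • b + (1 : F) • b = 0 := by rw [← add_smul, h2, zero_smul]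
      exact absurd (by simpa using add_right_cancel (h.trans h3.symm)) hab
  have := finrank_span_eq_card h
  rwa [Matrix.range_cons, Matrix.range_cons, Matrix.range_empty, Set.union_empty,
    Set.singleton_union] at this

theorem exists_isParallelRel_of_natCard_eq_two (hM : finrank F M = 4) (hF : Nat.card F = 2) :
    ∃ r : Submodule F M → Submodule F M → Prop, IsParallelRel F r := by
  classical
  have hfd : FiniteDimensional F M := Module.finite_of_finrank_pos (by omega)
  have : Finite M := Module.finite_of_finite F
  have h2 : ∀ x : M, 2 • x = 0 := by
    intro x
    have h2 : (1 : F) + 1 = 0 := by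
      obtain h | h := eq_zero_or_one_of_natCard_eq_two hF ((1 : F) + 1)
      · exact h
      · simp at h
    rw [two_nsmul, ← one_smul F x, ← add_smul, h2, zero_smul]
  -- `F` is only known to have two elements, so the explicit coordinates are transported by an
  -- additive isomorphism; lines over `F` are described by addition alone.
  let : Module (ZMod 2) M := AddCommGroup.zmodModule h2
  have hM2 : finrank (ZMod 2) M = 4 := by
    have h1 := Module.natCard_eq_pow_finrank (K := ZMod 2) (V := M)
    rw [Module.natCard_eq_pow_finrank (K := F) (V := M), hF, hM, Nat.card_zmod] at h1
    exact (Nat.pow_right_injective le_rfl h1).symm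
  let e : M ≃ₗ[ZMod 2] ZMod 2 × ZMod 2 × ZMod 2 × ZMod 2 :=
    LinearEquiv.ofFinrankEq _ _ (by simp [hM2])
  let line : Fin 7 → Fin 5 → Submodule F M := fun i j ↦
    Submodule.span F {e.symm (spreadGen i j 0), e.symm (spreadGen i j 1)}
  have hline : ∀ i j x, x ∈ line i j ↔ OnLine i j (e x) := by
    intro i j x
    simp only [line, mem_span_pair_of_natCard_eq_two hF, OnLine, ← map_add,
      LinearEquiv.eq_symm_apply, LinearEquiv.map_eq_zero_iff]
  have hdim : ∀ i j, finrank F (line i j) = 2 := by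
    intro i j
    obtain ⟨h1, h2, h3⟩ := spreadGen_ne i j
    exact finrank_span_pair_of_natCard_eq_two hF (by simpa using h1) (by simpa using h2)
      (by simpa using h3)
  refine exists_isParallelRel_of_family (fun i ↦ Finset.univ.image (line i)) ?_ ?_ ?_ ?_ ?_
  · intro i
    exact Finset.card_image_le.trans (by simp [hF])
  · intro i l hl
    obtain ⟨j, -, rfl⟩ := Finset.mem_image.1 hl
    exact hdim i j
  · intro i x
    obtain ⟨j, hj⟩ := exists_onLine i (e x)
    exact ⟨_, Finset.mem_image_of_mem _ (Finset.mem_univ j), (hline i j x).2 hj⟩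
  · intro l hl
    let b := finBasisOfFinrankEq F l hl
    have hne : ∀ k, e (b k) ≠ 0 := fun k ↦ by simpa using b.ne_zero k
    obtain ⟨i, j, h0, h1⟩ := exists_onLine_pair (e (b 0)) (e (b 1)) (hne 0) (hne 1) (by
      intro h
      have := b.injective (Subtype.ext (e.injective h))
      simp at this)
    refine ⟨i, Finset.mem_image.2 ⟨j, Finset.mem_univ _, ?_⟩⟩
    symm
    refine Submodule.eq_of_le_of_finrank_eq (fun x hx ↦ ?_) (by rw [hl, hdim])
    have hb := b.sum_repr ⟨x, hx⟩
    rw [Fin.sum_univ_two] at hb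
    have hx' : x = b.repr ⟨x, hx⟩ 0 • (b 0 : M) + b.repr ⟨x, hx⟩ 1 • (b 1 : M) :=
      (congrArg Subtype.val hb).symm
    rw [hx']
    exact (line i j).add_mem ((line i j).smul_mem _ ((hline i j _).2 h0))
      ((line i j).smul_mem _ ((hline i j _).2 h1))
  · intro i i' l hi hi'
    obtain ⟨j, -, rfl⟩ := Finset.mem_image.1 hi
    obtain ⟨j', -, h⟩ := Finset.mem_image.1 hi'
    have hmem : ∀ k, OnLine i j (spreadGen i' j' k) := by
      intro k
      rw [← e.apply_symm_apply (spreadGen i' j' k), ← hline, ← h]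
      apply Submodule.subset_span
      fin_cases k <;> simp
    rw [eq_of_onLine i i' j j' (hmem 0) (hmem 1)]

end OrderTwo

/-- Every three-dimensional projective space over a finite field has a parallelism. -/
theorem exists_isParallelRel {F M : Type*} [Field F] [Finite F] [AddCommGroup M] [Module F M]
    (hM : finrank F M = 4) : ∃ r : Submodule F M → Submodule F M → Prop, IsParallelRel F r := by
  by_cases hF : Nat.card F = 2
  · exact exists_isParallelRel_of_natCard_eq_two hM hF
  · exact exists_isParallelRel_of_natCard_ne_two hM hF

/-! ### Points and lines as subspaces -/

section Lines

variable {F M : Type*} [Field F] [AddCommGroup M] [Module F M] [FiniteDimensional F M]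

theorem Submodule.exists_le_finrank_eq (A : Submodule F M) {k : ℕ} (hA : finrank F A ≤ k)
    (hk : k ≤ finrank F M) : ∃ B : Submodule F M, A ≤ B ∧ finrank F B = k := by
  induction k, hA using Nat.le_induction with
  | base => exact ⟨A, le_rfl, rfl⟩
  | succ k hA ih =>
    obtain ⟨B, hAB, hB⟩ := ih (by omega)
    obtain ⟨v, hv⟩ : ∃ v, v ∉ B := by
      by_contra! h
      rw [(Submodule.eq_top_iff'.2 h : B = ⊤), finrank_top] at hB
      omega
    exact ⟨B ⊔ F ∙ v, hAB.trans le_sup_left, by rw [Submodule.finrank_sup_span_singleton hv, hB]⟩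

theorem finrank_span_singleton_sup {x y : M} (hx : x ≠ 0) (hy : y ∉ F ∙ x) :
    finrank F ↥((F ∙ x) ⊔ F ∙ y) = 2 := by
  rw [Submodule.finrank_sup_span_singleton hy, finrank_span_singleton hx]

theorem Submodule.exists_eq_span_singleton_sup {m : Submodule F M} (hm : finrank F m = 2) {x : M}
    (hx : x ≠ 0) (hxm : x ∈ m) : ∃ y, y ∉ F ∙ x ∧ m = (F ∙ x) ⊔ F ∙ y := by
  obtain ⟨y, hym, hy⟩ : ∃ y ∈ m, y ∉ F ∙ x := by
    by_contra! h
    have := Submodule.finrank_mono (show m ≤ F ∙ x from h)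
    rw [hm, finrank_span_singleton hx] at this
    omega
  refine ⟨y, hy, (Submodule.eq_of_le_of_finrank_eq (sup_le ?_ ?_) ?_).symm⟩
  · rwa [Submodule.span_singleton_le_iff_mem]
  · rwa [Submodule.span_singleton_le_iff_mem]
  · rw [finrank_span_singleton_sup hx hy, hm]

theorem Submodule.exists_span_singleton_of_finrank_eq_one {A : Submodule F M}
    (hA : finrank F A = 1) : ∃ x, A = F ∙ x := by
  obtain ⟨x, -, hx⟩ := finrank_eq_one_iff'.1 hA
  refine ⟨x, le_antisymm (fun y hy ↦ ?_) ?_⟩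
  · obtain ⟨c, hc⟩ := hx ⟨y, hy⟩
    exact Submodule.mem_span_singleton.2 ⟨c, congrArg Subtype.val hc⟩
  · rw [Submodule.span_singleton_le_iff_mem]
    exact x.2

theorem Submodule.le_of_finrank_inf_eq {W K : Submodule F M} {k : ℕ} (hW : finrank F W = k)
    (h : finrank F ↥(W ⊓ K) = k) : W ≤ K :=
  inf_eq_left.1 (Submodule.eq_of_le_of_finrank_eq inf_le_left (by rw [h, hW]))

end Lines

/-! ### Relations between lines of two spaces -/

/-- A relation between the lines of `Q` and those of `S`: the lines related to a given line cover
all points on either side, and each line of `Q` is related to at most `q ^ 2 + 1` lines of `S`. -/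
structure IsCrossRel (F : Type*) {Q S : Type*} [Field F] [AddCommGroup Q] [Module F Q]
    [AddCommGroup S] [Module F S] (R : Submodule F Q → Submodule F S → Prop) : Prop where
  finrank_eq : ∀ m l, R m l → finrank F l = 2
  cover_right : ∀ m : Submodule F Q, finrank F m = 2 → ∀ x, ∃ l, R m l ∧ x ∈ l
  cover_left : ∀ l : Submodule F S, finrank F l = 2 → ∀ x, ∃ m : Submodule F Q, finrank F m = 2 ∧ R m l ∧ x ∈ m
  card_le : ∀ m, ∃ s : Finset (Submodule F S), s.card ≤ Nat.card F ^ 2 + 1 ∧ ∀ l, R m l → l ∈ s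

section Cross

variable {F Q S : Type*} [Field F] [Finite F] [AddCommGroup Q] [Module F Q]
  [FiniteDimensional F Q] [AddCommGroup S] [Module F S]

/-- Transport of a parallelism of `S` to a relation between the lines of `Q` and of `S`, by the
projection `π`. -/
theorem exists_isCrossRel (hS : finrank F S = 4) (π : Q →ₗ[F] S) (hπ : Function.Surjective π) :
    ∃ R : Submodule F Q → Submodule F S → Prop, IsCrossRel F R := by
  classical
  have hfd : FiniteDimensional F S := Module.finite_of_finrank_pos (by omega)
  obtain ⟨r, hr⟩ := exists_isParallelRel hS
  have : Nontrivial S := Module.nontrivial_of_finrank_pos (R := F) (by omega)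
  obtain ⟨x₀, hx₀⟩ := exists_ne (0 : S)
  obtain ⟨d, -, hd⟩ := Submodule.exists_le_finrank_eq (⊥ : Submodule F S) (k := 2) (by simp)
    (by omega)
  -- A line of `Q` is attached to its image if that is a line, and to the join of its image with the
  -- fixed point `x₀` if that is a line. The default `d` only makes `f` line-valued everywhere.
  let f : Submodule F Q → Submodule F S := fun m ↦
    if finrank F (m.map π) = 2 then m.map π
    else if finrank F ↥((F ∙ x₀) ⊔ m.map π) = 2 then (F ∙ x₀) ⊔ m.map π else d
  have hf : ∀ m, finrank F (f m) = 2 := by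
    intro m
    by_cases h1 : finrank F (m.map π) = 2
    · rwa [show f m = m.map π from if_pos h1]
    · by_cases h2 : finrank F ↥((F ∙ x₀) ⊔ m.map π) = 2
      · rwa [show f m = (F ∙ x₀) ⊔ m.map π from (if_neg h1).trans (if_pos h2)]
      · rwa [show f m = d from (if_neg h1).trans (if_neg h2)]
  have hf₁ : ∀ (m : Submodule F Q) (n : Submodule F S), m.map π = n → finrank F n = 2 → f m = n := by
    rintro m _ rfl h
    exact if_pos h
  have hf₂ : ∀ (m : Submodule F Q) (n : Submodule F S), m.map π = n → finrank F n ≠ 2 →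
      finrank F ↥((F ∙ x₀) ⊔ n) = 2 → f m = (F ∙ x₀) ⊔ n := by
    rintro m _ rfl h h'
    exact (if_neg h).trans (if_pos h')
  refine ⟨fun m l ↦ r (f m) l, ⟨fun m l h ↦ hr.finrank_eq _ _ h, fun m _ x ↦ hr.cover _ (hf m) x,
    ?_, fun m ↦ hr.card_le _⟩⟩
  intro l hl
  have key : ∀ x, π x ≠ 0 → ∃ m : Submodule F Q, finrank F m = 2 ∧ r (f m) l ∧ x ∈ m := by
    intro x hx
    obtain ⟨m₀, hm₀, hxm⟩ := hr.cover l hl (π x)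
    obtain ⟨y₀, hy₀, rfl⟩ := Submodule.exists_eq_span_singleton_sup (hr.finrank_eq _ _ hm₀) hx hxm
    obtain ⟨y, rfl⟩ := hπ y₀
    have hmap : ((F ∙ x) ⊔ F ∙ y).map π = (F ∙ π x) ⊔ F ∙ π y := by
      rw [Submodule.map_sup, LinearMap.map_span, LinearMap.map_span, Set.image_singleton,
        Set.image_singleton]
    have hyx : y ∉ F ∙ x := by
      intro h
      obtain ⟨c, rfl⟩ := Submodule.mem_span_singleton.1 h
      exact hy₀ (Submodule.mem_span_singleton.2 ⟨c, (map_smul π c x).symm⟩)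
    refine ⟨(F ∙ x) ⊔ F ∙ y, finrank_span_singleton_sup (fun h ↦ hx (by rw [h, map_zero])) hyx,
      ?_, Submodule.mem_sup_left (Submodule.mem_span_singleton_self x)⟩
    rw [hf₁ _ _ hmap (hr.finrank_eq _ _ hm₀)]
    exact hr.symm _ _ hm₀
  intro x
  by_cases hx : π x = 0
  · by_cases hx0 : x = 0
    · obtain ⟨x', rfl⟩ := hπ x₀
      obtain ⟨m, hm, hml, -⟩ := key x' hx₀
      exact ⟨m, hm, hml, hx0 ▸ m.zero_mem⟩
    -- A point `x` of `ker π` has no image to work with. The line `m₀` of the class through `x₀`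
    -- replaces it: joining `x` to a lift of a second point of `m₀` gives a line that `f` sends to
    -- `m₀`. This is why `f` joins degenerate images with `x₀`.
    · obtain ⟨m₀, hm₀, hxm⟩ := hr.cover l hl x₀
      obtain ⟨y₀, hy₀, rfl⟩ :=
        Submodule.exists_eq_span_singleton_sup (hr.finrank_eq _ _ hm₀) hx₀ hxm
      obtain ⟨y, rfl⟩ := hπ y₀
      have hmap : ((F ∙ x) ⊔ F ∙ y).map π = F ∙ π y := by
        rw [Submodule.map_sup, LinearMap.map_span, LinearMap.map_span, Set.image_singleton,
          Set.image_singleton, hx, Submodule.span_zero_singleton, bot_sup_eq]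
      have hy : π y ≠ 0 := fun h ↦ hy₀ (h ▸ Submodule.zero_mem _)
      have hyx : y ∉ F ∙ x := by
        intro h
        obtain ⟨c, rfl⟩ := Submodule.mem_span_singleton.1 h
        exact hy (by rw [map_smul, hx, smul_zero])
      refine ⟨(F ∙ x) ⊔ F ∙ y, finrank_span_singleton_sup hx0 hyx, ?_,
        Submodule.mem_sup_left (Submodule.mem_span_singleton_self x)⟩
      rw [hf₂ _ _ hmap (by rw [finrank_span_singleton hy]; norm_num) (hr.finrank_eq _ _ hm₀)]
      exact hr.symm _ _ hm₀
  · exact key x hx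

end Cross

/-! ### Assembling the coverings -/

section Cover

variable {F V Q : Type*} [Field F] [Finite F] [AddCommGroup V] [Module F V] [Finite V]
  [AddCommGroup Q] [Module F Q] [Finite Q]

/-- The four-dimensional spaces that meet `ker p` in a line `l` and are mapped onto a line `m`
related to `l` cover all planes that meet `ker p` in a point or a line. -/
theorem exists_cover_of_isCrossRel (p : V →ₗ[F] Q) (hp : Function.Surjective p)
    (hker : finrank F (LinearMap.ker p) = 4)
    {R : Submodule F Q → Submodule F (LinearMap.ker p) → Prop} (hR : IsCrossRel F R) :
    ∃ Y : Finset (Submodule F V),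
      Y.card ≤ Nat.card {m : Submodule F Q // finrank F m = 2} *
        ((Nat.card F ^ 2 + 1) * Nat.card F ^ 4) ∧
      (∀ U ∈ Y, finrank F U = 4) ∧
      ∀ W : Submodule F V, finrank F W = 3 → finrank F ↥(W ⊓ LinearMap.ker p) ≠ 0 →
        finrank F ↥(W ⊓ LinearMap.ker p) ≠ 3 → ∃ U ∈ Y, W ≤ U := by
  classical
  have hfin := Fintype.ofFinite {m : Submodule F Q // finrank F m = 2}
  choose s hs hRs using hR.card_le
  have hmapl : ∀ l : Submodule F (LinearMap.ker p),
      finrank F (l.map (LinearMap.ker p).subtype) = finrank F l := fun l ↦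
    Submodule.finrank_map_subtype_eq _ _
  have hlift : ∀ (m : Submodule F Q) (l : Submodule F (LinearMap.ker p)), finrank F m = 2 →
      finrank F l = 2 → ∃ Y : Finset (Submodule F V), Y.card ≤ Nat.card F ^ 4 ∧
        (∀ U ∈ Y, finrank F U = 4) ∧ ∀ W : Submodule F V, W.map p ≤ m →
          W ⊓ LinearMap.ker p ≤ l.map (LinearMap.ker p).subtype → ∃ U ∈ Y, W ≤ U := by
    intro m l hm hl
    -- Both `m` and `ker p` modulo `l` have dimension 2, whence `q ^ (2 * 2)` lifts.
    obtain ⟨Y, hY, hdim, hcov⟩ := exists_lift_all p hp m (l.map (LinearMap.ker p).subtype)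
      (Submodule.map_subtype_le _ _) (t := 2) (by rw [hmapl, hl, hker])
    rw [hm] at hY
    exact ⟨Y, hY, fun U hU ↦ by rw [hdim U hU, hm, hmapl, hl], hcov⟩
  choose! Y hY hdim hcov using hlift
  refine ⟨Finset.univ.biUnion fun m : {m : Submodule F Q // finrank F m = 2} ↦
    ((s m.1).filter fun l : Submodule F (LinearMap.ker p) ↦ finrank F l = 2).biUnion fun l ↦
      Y m.1 l, ?_, ?_, ?_⟩
  · rw [Nat.card_eq_fintype_card, ← Finset.card_univ]
    refine Finset.card_biUnion_le_card_mul _ _ _ fun m _ ↦ ?_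
    refine (Finset.card_biUnion_le_card_mul _ _ (Nat.card F ^ 4) fun l hl ↦
      hY _ _ m.2 (Finset.mem_filter.1 hl).2).trans (Nat.mul_le_mul_right _ ?_)
    exact (Finset.card_filter_le _ _).trans (hs _)
  · intro U hU
    simp only [Finset.mem_biUnion, Finset.mem_univ, true_and, Finset.mem_filter] at hU
    obtain ⟨m, l, ⟨-, hl⟩, hU⟩ := hU
    exact hdim _ _ m.2 hl U hU
  · intro W hW h0 h3
    have hsum := Submodule.finrank_map_add_finrank_inf_ker p W
    have hle : finrank F ↥(W ⊓ LinearMap.ker p) ≤ finrank F W :=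
      Submodule.finrank_mono inf_le_left
    suffices h : ∃ (m : Submodule F Q) (l : Submodule F (LinearMap.ker p)), finrank F m = 2 ∧ R m l ∧ W.map p ≤ m ∧
        W ⊓ LinearMap.ker p ≤ l.map (LinearMap.ker p).subtype by
      obtain ⟨m, l, hm, hml, hWm, hWl⟩ := h
      have hl := hR.finrank_eq m l hml
      obtain ⟨U, hU, hWU⟩ := hcov m l hm hl W hWm hWl
      refine ⟨U, ?_, hWU⟩
      simp only [Finset.mem_biUnion, Finset.mem_univ, true_and, Finset.mem_filter]
      exact ⟨⟨m, hm⟩, l, ⟨hRs m l hml, hl⟩, hU⟩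
    -- If `W` meets the kernel in a point, its image is a line `m`, and `cover_right` finds `l`
    -- through the point. If it meets the kernel in a line `l`, its image is a point, and
    -- `cover_left` finds `m` through that point.
    obtain h1 | h2 : finrank F ↥(W ⊓ LinearMap.ker p) = 1 ∨
        finrank F ↥(W ⊓ LinearMap.ker p) = 2 := by omega
    · obtain ⟨x, hx⟩ := Submodule.exists_span_singleton_of_finrank_eq_one h1
      have hxk : x ∈ LinearMap.ker p := by
        have : x ∈ W ⊓ LinearMap.ker p := hx ▸ Submodule.mem_span_singleton_self x
        exact this.2
      have hm : finrank F (W.map p) = 2 := by omega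
      obtain ⟨l, hl, hxl⟩ := hR.cover_right _ hm ⟨x, hxk⟩
      refine ⟨_, l, hm, hl, le_rfl, ?_⟩
      rw [hx, Submodule.span_singleton_le_iff_mem]
      exact ⟨_, hxl, rfl⟩
    · obtain ⟨x, hx⟩ := Submodule.exists_span_singleton_of_finrank_eq_one
        (show finrank F (W.map p) = 1 by omega)
      have hl : finrank F (W.comap (LinearMap.ker p).subtype) = 2 := by
        rw [← hmapl, Submodule.map_comap_subtype, inf_comm, h2]
      obtain ⟨m, hm, hml, hxm⟩ := hR.cover_left _ hl x
      refine ⟨m, _, hm, hml, ?_, ?_⟩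
      · rwa [hx, Submodule.span_singleton_le_iff_mem]
      · rw [Submodule.map_comap_subtype, inf_comm]

theorem exists_cover_of_finrank_eq_eight (p : V →ₗ[F] Q) (hp : Function.Surjective p)
    (hker : finrank F (LinearMap.ker p) = 4) (hQ : finrank F Q = 4) :
    ∃ X : Finset (Submodule F V),
      X.card ≤ Nat.card F ^ 12 + Nat.card F ^ 4 * (Nat.card F ^ 2 + 1) ^ 2 *
        (Nat.card F ^ 2 + Nat.card F + 1) + 1 ∧
      (∀ U ∈ X, finrank F U = 4) ∧
      ∀ W : Submodule F V, finrank F W = 3 → ∃ U ∈ X, W ≤ U := by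
  classical
  let e : Q ≃ₗ[F] LinearMap.ker p := LinearEquiv.ofFinrankEq _ _ (by rw [hker, hQ])
  obtain ⟨R, hR⟩ := exists_isCrossRel hker e.toLinearMap e.surjective
  obtain ⟨Y, hY, hYdim, hYcov⟩ := exists_cover_of_isCrossRel p hp hker hR
  obtain ⟨Z, hZ, hZdim, hZcov⟩ := exists_lift_mrd p hp ⊤ (by rw [finrank_top, hQ]) hker.ge
  refine ⟨insert (LinearMap.ker p) (Z ∪ Y), ?_, ?_, ?_⟩
  · have h1 := Finset.card_insert_le (LinearMap.ker p) (Z ∪ Y)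
    have h2 := Finset.card_union_le Z Y
    have h3 := Nat.mul_le_mul_right ((Nat.card F ^ 2 + 1) * Nat.card F ^ 4)
      (natCard_lines_le_of_finrank_eq_four hQ)
    rw [hker] at hZ
    calc _ ≤ Nat.card F ^ (3 * 4) + (Nat.card F ^ 2 + 1) * (Nat.card F ^ 2 + Nat.card F + 1) *
          ((Nat.card F ^ 2 + 1) * Nat.card F ^ 4) + 1 := by omega
      _ = _ := by ring
  · intro U hU
    rw [Finset.mem_insert, Finset.mem_union] at hU
    obtain rfl | hU | hU := hU
    · exact hker
    · exact hZdim U hU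
    · exact hYdim U hU
  · intro W hW
    simp only [Finset.mem_insert, Finset.mem_union]
    by_cases h0 : finrank F ↥(W ⊓ LinearMap.ker p) = 0
    · obtain ⟨U, hU, h⟩ := hZcov W hW le_top (Submodule.finrank_eq_zero.1 h0)
      exact ⟨U, Or.inr (Or.inl hU), h⟩
    by_cases h3 : finrank F ↥(W ⊓ LinearMap.ker p) = 3
    · exact ⟨_, Or.inl rfl, Submodule.le_of_finrank_inf_eq hW h3⟩
    · obtain ⟨U, hU, h⟩ := hYcov W hW h0 h3
      exact ⟨U, Or.inr (Or.inr hU), h⟩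

theorem exists_cover_of_finrank_eq_ten {Q' : Type*} [AddCommGroup Q'] [Module F Q'] [Finite Q']
    (p : V →ₗ[F] Q) (hp : Function.Surjective p) (hker : finrank F (LinearMap.ker p) = 4)
    (hQ : finrank F Q = 6) (ρ : Q →ₗ[F] Q') (hρ : Function.Surjective ρ)
    (hQ' : finrank F Q' = 4) :
    ∃ X : Finset (Submodule F V),
      X.card ≤ Nat.card F ^ 18 + Nat.card F ^ 4 * (Nat.card F ^ 2 + 1) *
        (Nat.card F ^ 2 + Nat.card F + 1) * (Nat.card F ^ 8 + Nat.card F ^ 6 + Nat.card F ^ 4 +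
          Nat.card F ^ 3 + Nat.card F ^ 2 + 1) + 1 ∧
      (∀ U ∈ X, finrank F U = 4) ∧
      ∀ W : Submodule F V, finrank F W = 3 → ∃ U ∈ X, W ≤ U := by
  classical
  have hfin := Fintype.ofFinite {m : Submodule F Q' // finrank F m = 2}
  let e : Q' ≃ₗ[F] LinearMap.ker p := LinearEquiv.ofFinrankEq _ _ (by rw [hker, hQ'])
  obtain ⟨R, hR⟩ := exists_isCrossRel hker (e.toLinearMap ∘ₗ ρ) (e.surjective.comp hρ)
  obtain ⟨Y, hY, hYdim, hYcov⟩ := exists_cover_of_isCrossRel p hp hker hR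
  have hkerρ : finrank F (LinearMap.ker ρ) = 2 := by
    have := LinearMap.finrank_range_add_finrank_ker ρ
    rw [LinearMap.range_eq_top.2 hρ, finrank_top, hQ, hQ'] at this
    omega
  have hp' : Function.Surjective (ρ ∘ₗ p) := hρ.comp hp
  have hker' : finrank F (LinearMap.ker (ρ ∘ₗ p)) = 6 := by
    have h1 := LinearMap.finrank_range_add_finrank_ker (ρ ∘ₗ p)
    have h2 := LinearMap.finrank_range_add_finrank_ker p
    rw [LinearMap.range_eq_top.2 hp', finrank_top, hQ'] at h1
    rw [LinearMap.range_eq_top.2 hp, finrank_top, hQ, hker] at h2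
    omega
  obtain ⟨Z, hZ, hZdim, hZcov⟩ := exists_lift_mrd (ρ ∘ₗ p) hp' ⊤ (by rw [finrank_top, hQ'])
    (by omega)
  have hcomap : ∀ m : {m : Submodule F Q' // finrank F m = 2}, finrank F (m.1.comap ρ) = 4 := by
    intro m
    rw [← Submodule.finrank_map_add_finrank_inf_ker ρ,
      Submodule.map_comap_eq_of_surjective hρ, m.2, inf_eq_right.2 (LinearMap.ker_le_comap ρ),
      hkerρ]
  -- For each line of `Q'`, a code over its 4-dimensional preimage in `Q`, for planes that meet `ker
  -- (ρ ∘ₗ p)` but not `ker p`.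
  choose T hT hTdim hTcov using fun m ↦ exists_lift_mrd p hp _ (hcomap m) hker.ge
  refine ⟨insert (LinearMap.ker p) (Z ∪ (Finset.univ.biUnion T ∪ Y)), ?_, ?_, ?_⟩
  · have h1 := Finset.card_insert_le (LinearMap.ker p) (Z ∪ (Finset.univ.biUnion T ∪ Y))
    have h2 := Finset.card_union_le Z (Finset.univ.biUnion T ∪ Y)
    have h3 := Finset.card_union_le (Finset.univ.biUnion T) Y
    have h4 := Finset.card_biUnion_le_card_mul Finset.univ T _ fun m _ ↦ hT m
    rw [Finset.card_univ, ← Nat.card_eq_fintype_card, hker] at h4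
    have h5 := Nat.mul_le_mul_right (Nat.card F ^ (3 * 4))
      (natCard_lines_le_of_finrank_eq_four hQ')
    have h6 := Nat.mul_le_mul_right ((Nat.card F ^ 2 + 1) * Nat.card F ^ 4)
      (natCard_lines_le_of_finrank_eq_six hQ)
    rw [hker'] at hZ
    calc _ ≤ Nat.card F ^ (3 * 6) +
          ((Nat.card F ^ 2 + 1) * (Nat.card F ^ 2 + Nat.card F + 1) * Nat.card F ^ (3 * 4) +
            (Nat.card F ^ 4 + Nat.card F ^ 2 + 1) * (Nat.card F ^ 4 + Nat.card F ^ 3 +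
              Nat.card F ^ 2 + Nat.card F + 1) * ((Nat.card F ^ 2 + 1) * Nat.card F ^ 4)) +
            1 := by omega
      _ = _ := by ring
  · intro U hU
    simp only [Finset.mem_insert, Finset.mem_union, Finset.mem_biUnion, Finset.mem_univ,
      true_and] at hU
    obtain rfl | hU | ⟨m, hU⟩ | hU := hU
    · exact hker
    · exact hZdim U hU
    · exact hTdim m U hU
    · exact hYdim U hU
  · intro W hW
    simp only [Finset.mem_insert, Finset.mem_union, Finset.mem_biUnion, Finset.mem_univ, true_and]
    by_cases h0 : finrank F ↥(W ⊓ LinearMap.ker p) = 0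
    · by_cases h0' : W ⊓ LinearMap.ker (ρ ∘ₗ p) = ⊥
      · obtain ⟨U, hU, h⟩ := hZcov W hW le_top h0'
        exact ⟨U, Or.inr (Or.inl hU), h⟩
      · have h1 := Submodule.finrank_map_add_finrank_inf_ker (ρ ∘ₗ p) W
        have h2 : finrank F ↥(W ⊓ LinearMap.ker (ρ ∘ₗ p)) ≠ 0 := fun h ↦
          h0' (Submodule.finrank_eq_zero.1 h)
        -- The image of `W` in `Q'` has dimension at most 2; it may be smaller, so it is enlarged to
        -- a line.
        obtain ⟨m, hWm, hm⟩ := Submodule.exists_le_finrank_eq (W.map (ρ ∘ₗ p)) (k := 2)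
          (by omega) (by omega)
        obtain ⟨U, hU, h⟩ := hTcov ⟨m, hm⟩ W hW
          (by rwa [← Submodule.map_le_iff_le_comap, ← Submodule.map_comp])
          (Submodule.finrank_eq_zero.1 h0)
        exact ⟨U, Or.inr (Or.inr (Or.inl ⟨_, hU⟩)), h⟩
    by_cases h3 : finrank F ↥(W ⊓ LinearMap.ker p) = 3
    · exact ⟨_, Or.inl rfl, Submodule.le_of_finrank_inf_eq hW h3⟩
    · obtain ⟨U, hU, h⟩ := hYcov W hW h0 h3
      exact ⟨U, Or.inr (Or.inr (Or.inr hU)), h⟩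

end Cover

/-! ### Projections with prescribed kernel, and the final bounds -/

theorem exists_surjective_finrank_ker {F V : Type*} [Field F] [AddCommGroup V] [Module F V]
    [FiniteDimensional F V] {d k : ℕ} (h : finrank F V = d + k) :
    ∃ p : V →ₗ[F] (Fin d → F), Function.Surjective p ∧ finrank F (LinearMap.ker p) = k := by
  let e : V ≃ₗ[F] (Fin d → F) × (Fin k → F) :=
    LinearEquiv.ofFinrankEq _ _ (by rw [h, finrank_prod, finrank_fin_fun F, finrank_fin_fun F])
  have hp : Function.Surjective (LinearMap.fst F (Fin d → F) (Fin k → F) ∘ₗ e.toLinearMap) :=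
    fun x ↦ ⟨e.symm (x, 0), by simp⟩
  refine ⟨_, hp, ?_⟩
  have := LinearMap.finrank_range_add_finrank_ker
    (LinearMap.fst F (Fin d → F) (Fin k → F) ∘ₗ e.toLinearMap)
  rw [LinearMap.range_eq_top.2 hp, finrank_top, finrank_fin_fun, h] at this
  omega

theorem qCoveringNumber_le {F : Type*} [Field F] {n k r : ℕ}
    {X : Finset (Submodule F (Fin n → F))} (hX : IsQCoveringDesign F n k r X) :
    qCoveringNumber F n k r ≤ X.card :=
  Nat.sInf_le ⟨X, hX, rfl⟩

/-- A design must be supplied, since the infimum of an empty set of naturals is `0`; the lower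
bounds take it from the constructions for the upper bounds. -/
theorem exists_card_eq_qCoveringNumber {F : Type*} [Field F] {n k r : ℕ}
    {X : Finset (Submodule F (Fin n → F))} (hX : IsQCoveringDesign F n k r X) :
    ∃ Y, IsQCoveringDesign F n k r Y ∧ Y.card = qCoveringNumber F n k r :=
  Nat.sInf_mem (s := {N | ∃ Y, IsQCoveringDesign F n k r Y ∧ Y.card = N}) ⟨_, X, hX, rfl⟩

theorem corollary5p5 {F : Type*} [Field F] [Finite F] (q : ℕ) (hq : Nat.card F = q) :
    (q ^ 12 + q ^ 2 * (q ^ 4 + 1) * (q ^ 2 + 1) * (q ^ 2 + q + 1) + 1 ≤ qCoveringNumber F 8 4 3 ∧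
      qCoveringNumber F 8 4 3 ≤ q ^ 12 + q ^ 4 * (q ^ 2 + 1) ^ 2 * (q ^ 2 + q + 1) + 1) ∧
    ((q ^ 4 + 1) * (q ^ 6 + q ^ 3 + 1) * (q ^ 8 + q ^ 6 + q ^ 4 + q ^ 2 + 1) ≤
        qCoveringNumber F 10 4 3 ∧
      qCoveringNumber F 10 4 3 ≤
        q ^ 18 + q ^ 4 * (q ^ 2 + 1) * (q ^ 2 + q + 1) *
          (q ^ 8 + q ^ 6 + q ^ 4 + q ^ 3 + q ^ 2 + 1) + 1) := by
  subst hq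
  have hq := two_le_natCard (F := F)
  obtain ⟨p, hp, hker⟩ := exists_surjective_finrank_ker (F := F) (V := Fin 8 → F) (d := 4) (k := 4)
    (by simp)
  obtain ⟨X, hX, hXdim, hXcov⟩ := exists_cover_of_finrank_eq_eight p hp hker (by simp)
  obtain ⟨p', hp', hker'⟩ := exists_surjective_finrank_ker (F := F) (V := Fin 10 → F) (d := 6)
    (k := 4) (by simp)
  obtain ⟨ρ, hρ, -⟩ := exists_surjective_finrank_ker (F := F) (V := Fin 6 → F) (d := 4)
    (k := 2) (by simp)
  obtain ⟨X', hX', hXdim', hXcov'⟩ := exists_cover_of_finrank_eq_ten p' hp' hker' (by simp) ρ hρ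
    (by simp)
  refine ⟨⟨?_, (qCoveringNumber_le ⟨hXdim, hXcov⟩).trans hX⟩, ?_,
    (qCoveringNumber_le ⟨hXdim', hXcov'⟩).trans hX'⟩
  · obtain ⟨Y, ⟨hYdim, hYcov⟩, hY⟩ := exists_card_eq_qCoveringNumber
      (F := F) (n := 8) (k := 4) (r := 3) ⟨hXdim, hXcov⟩
    rw [← hY]
    exact le_card_of_cover_four_three (by norm_num) Y (by simp) hYdim hYcov
      (schonheim_product_eight hq) rfl
  · obtain ⟨Y, ⟨hYdim, hYcov⟩, hY⟩ := exists_card_eq_qCoveringNumber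
      (F := F) (n := 10) (k := 4) (r := 3) ⟨hXdim', hXcov'⟩
    rw [← hY]
    exact le_card_of_cover_four_three (by norm_num) Y (by simp) hYdim hYcov
      (schonheim_product_ten hq) rfl
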